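/- All systems are finite-dimensional (and nonzero), $H(\rho)=-\mathrm{Tr}\{\rho\log_2\rho\}$, $I(A;B)=H(A)+H(B)-H(AB)$ and $I(A;B|C)=H(AC)+H(BC)-H(C)-H(ABC)$. A channel $\mathcal N^{A'\to B}$ is a map $\rho\mapsto\sum_k A_k\rho A_k^\dagger$ with $\sum_k A_k^\dagger A_k=I$; an isometric extension of it is an isometry $U:A'\to B\otimes E$ with $\mathcal N(\rho)=\mathrm{Tr}_E\{U\rho U^\dagger\}$, and then $\mathcal N^c(\rho)=\mathrm{Tr}_B\{U\rho U^\dagger\}$ is the complementary channel. $\mathcal N$ is antidegradable if there is a channel $\mathcal T^{E\to B}$ with $\mathcal T\circ\mathcal N^c=\mathcal N$. $\mathcal N$ is entanglement-breaking if, for every finite-dimensional system $R$ and every state $\rho^{RA'}$, the state $(\mathrm{id}_R\otimes\mathcal N)(\rho)$ is separable, i.e. of the form $\sum_z p(z)\,\sigma_z\otimes\theta_z$ with $p$ a probability distribution and $\sigma_z,\theta_z$ states. For $\lambda,\mu\ge 0$ let $$P_{\lambda,\mu}(\mathcal N)=\max_\sigma\Big( I(YX;B)_\sigma+\lambda\,[I(Y;B|X)_\sigma-I(Y;E|X)_\sigma]+\mu\,[I(YX;B)_\sigma-I(Y;E|X)_\sigma]\Big),$$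 where $\sigma^{XYBE}=\sum_{x,y}p(x,y)\,|x\rangle\langle x|^X\otimes|y\rangle\langle y|^Y\otimes U\rho_{x,y}U^\dagger$ ranges over all finite alphabets for $x$ and $y$, all joint distributions $p$ and all (mixed) states $\rho_{x,y}$ on $A'$, with $U$ an isometric extension of $\mathcal N$. Let $\lambda,\mu\ge0$. (1) If $\mathcal N$ is an antidegradable channel, then $$P_{\lambda,\mu}(\mathcal N)=(1+\mu)\max_{\omega} I(X;B)_\omega,\qquad \omega^{XB}=\sum_x p(x)\,|x\rangle\langle x|^X\otimes\mathcal N(\psi_x),$$ the maximum being over all finite ensembles $\{p(x),\psi_x\}$ of pure states of $A'$. Both maxima are attained, and the one defining $P_{\lambda,\mu}(\mathcal N)$ is attained for, and has the same value for, every choice of the isometric extension $U$. (2) If $\mathcal N$ is an antidegradable channel and $\mathcal M$ is an entanglement-breaking channel, then $$P_{\lambda,\mu}(\mathcal N\otimes\mathcal M)=P_{\lambda,\mu}(\mathcal N)+P_{\lambda,\mu}(\mathcal M),$$ where the maxima defining $P_{\lambda,\mu}(\mathcal M)$ and $P_{\lambda,\mu}(\mathcal N\otimes\mathcal M)$ are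 also attained, with a value independent of the isometric extension. -/

import Mathlib

open scoped ComplexOrder Kronecker

universe u

namespace PrivateDynamic

noncomputable section

/-! ### States, entropies, mutual informations

A finite-dimensional quantum system is given by a finite type labelling an orthonormal basis of
it; operators on the system are complex matrices indexed by that type, and a composite system is
indexed by the product type. -/

/-- Density operators. -/
def IsDensity {n : Type*} [Fintype n] (ρ : Matrix n n ℂ) : Prop :=
  ρ.PosSemidef ∧ ρ.trace = 1

/-- Pure states `|ψ⟩⟨ψ|` with `ψ` a unit vector. -/
def IsPureState {n : Type*} [Fintype n] (ρ : Matrix n n ℂ) : Prop :=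
  ρ.trace = 1 ∧ ∃ ψ : n → ℂ, ρ = Matrix.vecMulVec ψ (star ψ)

/-- The partial trace over the first factor. -/
def traceLeft {m n : Type*} [Fintype m] (ρ : Matrix (m × n) (m × n) ℂ) : Matrix n n ℂ :=
  Matrix.of fun j j' => ∑ i, ρ (i, j) (i, j')

/-- The partial trace over the second factor. -/
def traceRight {m n : Type*} [Fintype n] (ρ : Matrix (m × n) (m × n) ℂ) : Matrix m m ℂ :=
  Matrix.of fun i i' => ∑ j, ρ (i, j) (i', j)

/-- The partial trace over the middle factor of three. -/
def traceMiddle {l m n : Type*} [Fintype m] (ρ : Matrix (l × m × n) (l × m × n) ℂ) :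
    Matrix (l × n) (l × n) ℂ :=
  Matrix.of fun i i' => ∑ j, ρ (i.1, j, i.2) (i'.1, j, i'.2)

/-- The von Neumann entropy `- Tr (ρ log₂ ρ)`. The logarithm is taken by functional calculus, and
`Real.logb 2 0 = 0` implements the convention `0 log 0 = 0`. -/
def entropy {n : Type*} [Fintype n] [DecidableEq n] (ρ : Matrix n n ℂ) : ℝ :=
  -(ρ * cfc (Real.logb 2) ρ).trace.re

/-- The mutual information `I(A;B) = H(A) + H(B) - H(AB)`. -/
def mutualInfo {A B : Type*} [Fintype A] [DecidableEq A] [Fintype B] [DecidableEq B]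
    (ρ : Matrix (A × B) (A × B) ℂ) : ℝ :=
  entropy (traceRight ρ) + entropy (traceLeft ρ) - entropy ρ

/-- The conditional mutual information `I(A;B|C) = H(AC) + H(BC) - H(C) - H(ABC)`. -/
def condMutualInfo {A B C : Type*} [Fintype A] [DecidableEq A] [Fintype B] [DecidableEq B]
    [Fintype C] [DecidableEq C] (ρ : Matrix (A × B × C) (A × B × C) ℂ) : ℝ :=
  entropy (traceMiddle ρ) + entropy (traceLeft ρ) - entropy (traceLeft (traceLeft ρ)) - entropy ρ

/-! ### Channels -/

/-- Quantum channels (completely positive trace-preserving maps), in operator-sum form: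
`N ρ = ∑ₖ Kₖ ρ Kₖ†` with `∑ₖ Kₖ† Kₖ = 1`. -/
def IsChannel {A B : Type u} [Fintype A] [DecidableEq A] [Fintype B]
    (N : Matrix A A ℂ →ₗ[ℂ] Matrix B B ℂ) : Prop :=
  ∃ (κ : Type u) (_ : Fintype κ) (K : κ → Matrix B A ℂ),
    ∑ k, (K k).conjTranspose * K k = 1 ∧
      ∀ ρ, N ρ = ∑ k, K k * ρ * (K k).conjTranspose

/-- `V : A → B ⊗ E` is an isometric extension of `N`, with environment `E`. -/
def IsIsometricExtension {A B E : Type u} [Fintype A] [DecidableEq A] [Fintype B] [Fintype E]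
    (V : Matrix (B × E) A ℂ) (N : Matrix A A ℂ →ₗ[ℂ] Matrix B B ℂ) : Prop :=
  V.conjTranspose * V = 1 ∧ ∀ ρ, traceRight (V * ρ * V.conjTranspose) = N ρ

/-- `N` is antidegradable: for the complementary channel `ρ ↦ Tr_B (V ρ V†)` belonging to an
isometric extension `V` of `N`, there is a channel `T` from the environment to the output of `N`
which composed with the complementary channel gives `N`. -/
def IsAntidegradable {A B : Type u} [Fintype A] [DecidableEq A] [Fintype B]
    (N : Matrix A A ℂ →ₗ[ℂ] Matrix B B ℂ) : Prop :=
  ∃ (E : Type u) (_ : Fintype E) (_ : DecidableEq E) (V : Matrix (B × E) A ℂ)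
    (T : Matrix E E ℂ →ₗ[ℂ] Matrix B B ℂ),
    IsIsometricExtension V N ∧ IsChannel T ∧
      ∀ ρ, T (traceLeft (V * ρ * V.conjTranspose)) = N ρ

/-- The tensor product of linear maps between matrix algebras, i.e. the linear extension of
`ρ ⊗ σ ↦ N ρ ⊗ M σ` (see `tensorMap_kronecker`). -/
def tensorMap {A₁ B₁ A₂ B₂ : Type*} [Fintype A₁] [DecidableEq A₁] [Fintype A₂] [DecidableEq A₂]
    (N : Matrix A₁ A₁ ℂ →ₗ[ℂ] Matrix B₁ B₁ ℂ) (M : Matrix A₂ A₂ ℂ →ₗ[ℂ] Matrix B₂ B₂ ℂ) :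
    Matrix (A₁ × A₂) (A₁ × A₂) ℂ →ₗ[ℂ] Matrix (B₁ × B₂) (B₁ × B₂) ℂ :=
  ∑ a, ∑ a', ∑ c, ∑ c',
    (Matrix.entryLinearMap ℂ ℂ (a, c) (a', c')).smulRight
      (N (Matrix.single a a' 1) ⊗ₖ M (Matrix.single c c' 1))

theorem tensorMap_kronecker {A₁ B₁ A₂ B₂ : Type*} [Fintype A₁] [DecidableEq A₁] [Fintype A₂]
    [DecidableEq A₂] (N : Matrix A₁ A₁ ℂ →ₗ[ℂ] Matrix B₁ B₁ ℂ)
    (M : Matrix A₂ A₂ ℂ →ₗ[ℂ] Matrix B₂ B₂ ℂ) (ρ : Matrix A₁ A₁ ℂ) (σ : Matrix A₂ A₂ ℂ) :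
    tensorMap N M (ρ ⊗ₖ σ) = N ρ ⊗ₖ M σ := by
  have hN : N ρ = ∑ a, ∑ a', ρ a a' • N (Matrix.single a a' 1) := by
    conv_lhs => rw [Matrix.matrix_eq_sum_single ρ]
    simp only [map_sum, ← LinearMap.map_smul, Matrix.smul_single, smul_eq_mul, mul_one]
  have hM : M σ = ∑ c, ∑ c', σ c c' • M (Matrix.single c c' 1) := by
    conv_lhs => rw [Matrix.matrix_eq_sum_single σ]
    simp only [map_sum, ← LinearMap.map_smul, Matrix.smul_single, smul_eq_mul, mul_one]
  ext ⟨i, k⟩ ⟨j, l⟩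
  rw [Matrix.kroneckerMap_apply, hN, hM]
  simp only [tensorMap, LinearMap.sum_apply, LinearMap.smulRight_apply,
    Matrix.entryLinearMap_apply, Matrix.kroneckerMap_apply, Matrix.sum_apply, Matrix.smul_apply,
    smul_eq_mul]
  rw [Finset.sum_mul]
  refine Finset.sum_congr rfl fun a _ => ?_
  rw [Finset.sum_mul]
  refine Finset.sum_congr rfl fun a' _ => ?_
  rw [Finset.mul_sum]
  refine Finset.sum_congr rfl fun c _ => ?_
  rw [Finset.mul_sum]
  refine Finset.sum_congr rfl fun c' _ => ?_
  ring

/-- Separable states: convex combinations of product states. -/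
def IsSeparable {R B : Type u} [Fintype R] [Fintype B] (τ : Matrix (R × B) (R × B) ℂ) : Prop :=
  ∃ (Z : Type u) (_ : Fintype Z) (p : Z → ℝ) (σ : Z → Matrix R R ℂ) (θ : Z → Matrix B B ℂ),
    p ∈ stdSimplex ℝ Z ∧ (∀ z, IsDensity (σ z)) ∧ (∀ z, IsDensity (θ z)) ∧
      τ = ∑ z, (p z : ℂ) • (σ z ⊗ₖ θ z)

/-- `N` is entanglement-breaking: sending one part of any bipartite state, however entangled,
through `N` leaves a separable state. -/
def IsEntanglementBreaking {A B : Type u} [Fintype A] [DecidableEq A] [Fintype B]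
    (N : Matrix A A ℂ →ₗ[ℂ] Matrix B B ℂ) : Prop :=
  ∀ (R : Type u) [Fintype R] [DecidableEq R] (ρ : Matrix (R × A) (R × A) ℂ),
    IsDensity ρ → IsSeparable (tensorMap (LinearMap.id : Matrix R R ℂ →ₗ[ℂ] Matrix R R ℂ) N ρ)

/-! ### The private dynamic capacity formula -/

/-- The state `σ^{XYBE} = ∑_{x,y} p(x,y) |x⟩⟨x| ⊗ |y⟩⟨y| ⊗ V ρ_{x,y} V†`. -/
def privateState {A B E X Y : Type u} [Fintype A] [Fintype X] [DecidableEq X] [Fintype Y]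
    [DecidableEq Y] (p : X × Y → ℝ) (ρ : X → Y → Matrix A A ℂ) (V : Matrix (B × E) A ℂ) :
    Matrix (X × Y × B × E) (X × Y × B × E) ℂ :=
  ∑ x, ∑ y, (p (x, y) : ℂ) •
    (Matrix.single x x (1 : ℂ) ⊗ₖ
      (Matrix.single y y (1 : ℂ) ⊗ₖ (V * ρ x y * V.conjTranspose)))

/-- The marginal of `σ^{XYBE}` on `YX` and `B`. -/
def marginalYX_B {B E X Y : Type u} [Fintype E]
    (σ : Matrix (X × Y × B × E) (X × Y × B × E) ℂ) :
    Matrix ((Y × X) × B) ((Y × X) × B) ℂ :=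
  Matrix.of fun i i' => ∑ e, σ (i.1.2, i.1.1, i.2, e) (i'.1.2, i'.1.1, i'.2, e)

/-- The marginal of `σ^{XYBE}` on `Y`, `B` and `X`. -/
def marginalY_B_X {B E X Y : Type u} [Fintype E]
    (σ : Matrix (X × Y × B × E) (X × Y × B × E) ℂ) :
    Matrix (Y × B × X) (Y × B × X) ℂ :=
  Matrix.of fun i i' => ∑ e, σ (i.2.2, i.1, i.2.1, e) (i'.2.2, i'.1, i'.2.1, e)

/-- The marginal of `σ^{XYBE}` on `Y`, `E` and `X`. -/
def marginalY_E_X {B E X Y : Type u} [Fintype B]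
    (σ : Matrix (X × Y × B × E) (X × Y × B × E) ℂ) :
    Matrix (Y × E × X) (Y × E × X) ℂ :=
  Matrix.of fun i i' => ∑ b, σ (i.2.2, i.1, b, i.2.1) (i'.2.2, i'.1, b, i'.2.1)

/-- `I(YX;B) + lam [I(Y;B|X) - I(Y;E|X)] + mu [I(YX;B) - I(Y;E|X)]`. -/
def privateDynamicObjective {B E X Y : Type u} [Fintype B] [DecidableEq B] [Fintype E]
    [DecidableEq E] [Fintype X] [DecidableEq X] [Fintype Y] [DecidableEq Y] (lam mu : ℝ)
    (σ : Matrix (X × Y × B × E) (X × Y × B × E) ℂ) : ℝ :=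
  mutualInfo (marginalYX_B σ)
    + lam * (condMutualInfo (marginalY_B_X σ) - condMutualInfo (marginalY_E_X σ))
    + mu * (mutualInfo (marginalYX_B σ) - condMutualInfo (marginalY_E_X σ))

/-- The values of the objective, for an isometry `V : A → B ⊗ E`, over all finite alphabets `X`,
`Y`, all joint distributions on `X × Y` and all families of (mixed) input states. -/
def privateDynamicValues {A B E : Type u} [Fintype A] [Fintype B] [DecidableEq B] [Fintype E]
    [DecidableEq E] (lam mu : ℝ) (V : Matrix (B × E) A ℂ) : Set ℝ :=
  {r | ∃ (X Y : Type u) (_ : Fintype X) (_ : DecidableEq X) (_ : Fintype Y) (_ : DecidableEq Y)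
      (p : X × Y → ℝ) (ρ : X → Y → Matrix A A ℂ),
      p ∈ stdSimplex ℝ (X × Y) ∧ (∀ x y, IsDensity (ρ x y)) ∧
        r = privateDynamicObjective lam mu (privateState p ρ V)}

/-- The private dynamic capacity formula `P_{lam,mu}(N)`: the optimum of the objective over all
states `σ^{XYBE}` arising from an isometric extension of `N`. -/
def privateDynamicCapacity {A B : Type u} [Fintype A] [DecidableEq A] [Fintype B] [DecidableEq B]
    (lam mu : ℝ) (N : Matrix A A ℂ →ₗ[ℂ] Matrix B B ℂ) : ℝ :=
  sSup {r | ∃ (E : Type u) (_ : Fintype E) (_ : DecidableEq E) (V : Matrix (B × E) A ℂ),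
    IsIsometricExtension V N ∧ r ∈ privateDynamicValues lam mu V}

/-- `P_{lam,mu}(N)` is a genuine maximum, the same one for every isometric extension of `N`. -/
def IsPrivateDynamicMax {A B : Type u} [Fintype A] [DecidableEq A] [Fintype B] [DecidableEq B]
    (lam mu : ℝ) (N : Matrix A A ℂ →ₗ[ℂ] Matrix B B ℂ) : Prop :=
  ∀ (E : Type u) [Fintype E] [DecidableEq E] (V : Matrix (B × E) A ℂ),
    IsIsometricExtension V N →
      IsGreatest (privateDynamicValues lam mu V) (privateDynamicCapacity lam mu N)

/-! ### The Holevo quantity over pure-state ensembles -/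

/-- The state `ω^{XB} = ∑ₓ p(x) |x⟩⟨x| ⊗ N(ψₓ)`. -/
def cqState {A B X : Type u} [Fintype X] [DecidableEq X] (p : X → ℝ) (ψ : X → Matrix A A ℂ)
    (N : Matrix A A ℂ →ₗ[ℂ] Matrix B B ℂ) : Matrix (X × B) (X × B) ℂ :=
  ∑ x, (p x : ℂ) • (Matrix.single x x (1 : ℂ) ⊗ₖ N (ψ x))

/-- The values of `I(X;B)_ω` over all finite ensembles of pure input states. -/
def pureHolevoValues {A B : Type u} [Fintype A] [Fintype B] [DecidableEq B]
    (N : Matrix A A ℂ →ₗ[ℂ] Matrix B B ℂ) : Set ℝ :=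
  {r | ∃ (X : Type u) (_ : Fintype X) (_ : DecidableEq X) (p : X → ℝ) (ψ : X → Matrix A A ℂ),
      p ∈ stdSimplex ℝ X ∧ (∀ x, IsPureState (ψ x)) ∧ r = mutualInfo (cqState p ψ N)}

/-- The optimum of `I(X;B)_ω` over all finite ensembles of pure input states. -/
def pureHolevo {A B : Type u} [Fintype A] [Fintype B] [DecidableEq B]
    (N : Matrix A A ℂ →ₗ[ℂ] Matrix B B ℂ) : ℝ :=
  sSup (pureHolevoValues N)

end

end PrivateDynamic

namespace PrivateDynamic

noncomputable section

open Matrix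

/-! ### Spectral formulas for the entropy -/

/-! Write χ for `pureHolevo`, the largest Holevo information over pure-state ensembles.

For an antidegradable channel, the output is obtained by processing the environment, so data
processing gives I(Y;B|X) ≤ I(Y;E|X). The bracket weighted by `lam` is therefore nonpositive. Since
I(Y;E|X) ≥ 0 and I(YX;B) ≤ χ, the objective is at most (1 + mu) χ. A trivial Y with an optimal pure
ensemble on X reaches this bound. The environment enters only through entropies, and these depend on
the channel alone: with a reference system purifying the input, the environment has the same nonzero
spectrum as output and reference together. The maximum over pure ensembles exists because the Holevo
values are a continuous image of a compact convex hull.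

For part (2), separability of the Choi state puts an entanglement-breaking channel in
measure-and-prepare form (`IsEntanglementBreaking.isMeasurePrepare`), and such a channel is
antidegradable because its environment can carry the measurement outcome
(`IsMeasurePrepare.isAntidegradable`). Antidegradability survives tensor products, so the formula of
part (1) applies to N, M and N ⊗ M. What remains is additivity of χ. Product ensembles give one
direction. The other is Shor's argument: subadditivity bounds the entropy of the average output, and
conditioning on the measurement outcome bounds the entropy of each signal.

The analytic core is monotonicity of the relative entropy (`IsChannel.relEntropy_le`). It is proved
by integrating a resolvent quantity with a variational description, for which the Kadison–Schwarz
inequality suffices. -/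

/-- The summand `-x log₂ x` of the Shannon entropy. -/
def entropyTerm (x : ℝ) : ℝ := -(x * Real.logb 2 x)

@[simp] theorem entropyTerm_zero : entropyTerm 0 = 0 := by simp [entropyTerm]

@[simp] theorem entropyTerm_one : entropyTerm 1 = 0 := by simp [entropyTerm]

theorem entropyTerm_mul (x y : ℝ) :
    entropyTerm (x * y) = y * entropyTerm x + x * entropyTerm y := by
  rcases eq_or_ne x 0 with rfl | hx
  · simp
  rcases eq_or_ne y 0 with rfl | hy
  · simp
  simp only [entropyTerm, Real.logb_mul hx hy]
  ring

theorem entropyTerm_eq_negMulLog (x : ℝ) : entropyTerm x = Real.negMulLog x / Real.log 2 := by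
  simp only [entropyTerm, Real.negMulLog, Real.logb]
  ring

theorem continuous_entropyTerm : Continuous entropyTerm := by
  rw [funext entropyTerm_eq_negMulLog]
  exact Real.continuous_negMulLog.div_const _

section Spectral

variable {m n : Type*} [Fintype m] [DecidableEq m] [Fintype n] [DecidableEq n]

/-- Packages the spectral theorem with plain matrices: a single eigenbasis serves all functions `f`
at once, so entropies become finite sums over eigenvalues. -/
theorem exists_diagonalization {A : Matrix n n ℂ} (hA : A.IsHermitian) :
    ∃ (U : Matrix n n ℂ) (d : n → ℝ), U.conjTranspose * U = 1 ∧ U * U.conjTranspose = 1 ∧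
      A = U * diagonal (fun i => (d i : ℂ)) * U.conjTranspose ∧
      (A.PosSemidef → ∀ i, 0 ≤ d i) ∧
      ∀ f : ℝ → ℝ, cfc f A = U * diagonal (fun i => ((f (d i) : ℝ) : ℂ)) * U.conjTranspose := by
  refine ⟨hA.eigenvectorUnitary, hA.eigenvalues, ?_, ?_, ?_, fun h => h.eigenvalues_nonneg, ?_⟩
  · exact Unitary.coe_star_mul_self hA.eigenvectorUnitary
  · exact Unitary.coe_mul_star_self hA.eigenvectorUnitary
  · conv_lhs => rw [hA.spectral_theorem]
    rfl
  · intro f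
    rw [hA.cfc_eq]
    rfl

theorem roots_charpoly_conj_diagonal {U : Matrix n n ℂ} (hU : U.conjTranspose * U = 1)
    (d : n → ℂ) :
    (U * diagonal d * U.conjTranspose).charpoly.roots = Finset.univ.val.map d := by
  rw [Matrix.mul_assoc, charpoly_mul_comm, Matrix.mul_assoc, hU, Matrix.mul_one,
    charpoly_diagonal, Polynomial.roots_prod _ _
      (Finset.prod_ne_zero_iff.2 fun i _ => Polynomial.X_sub_C_ne_zero _)]
  simp

/-- Through the characteristic polynomial the entropy is visibly invariant under every operation
that preserves that polynomial up to factors of X. -/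
theorem entropy_eq_sum_roots {A : Matrix n n ℂ} (hA : A.IsHermitian) :
    entropy A = (A.charpoly.roots.map fun z => entropyTerm z.re).sum := by
  obtain ⟨U, d, hU, _, hd, _, hf⟩ := exists_diagonalization hA
  have h : A * cfc (Real.logb 2) A =
      U * diagonal (fun i => ((d i * Real.logb 2 (d i) : ℝ) : ℂ)) * U.conjTranspose := by
    rw [hf]
    conv_lhs => enter [1]; rw [hd]
    simp only [Matrix.mul_assoc]
    rw [← Matrix.mul_assoc U.conjTranspose U, hU, Matrix.one_mul,
      ← Matrix.mul_assoc (diagonal _) (diagonal _), diagonal_mul_diagonal]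
    simp
  rw [entropy, h, Matrix.trace_mul_cycle, hU, Matrix.one_mul, trace_diagonal]
  conv_rhs => rw [hd, roots_charpoly_conj_diagonal hU]
  simp [entropyTerm]

theorem isHermitian_conj_diagonal (U : Matrix n n ℂ) (d : n → ℝ) :
    (U * diagonal (fun i => (d i : ℂ)) * U.conjTranspose).IsHermitian :=
  isHermitian_mul_mul_conjTranspose U (isHermitian_diagonal_of_self_adjoint _ (by
    ext i
    simp [Pi.star_apply]))

theorem entropy_conj_diagonal {U : Matrix n n ℂ} (hU : U.conjTranspose * U = 1) (d : n → ℝ) :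
    entropy (U * diagonal (fun i => (d i : ℂ)) * U.conjTranspose) = ∑ i, entropyTerm (d i) := by
  rw [entropy_eq_sum_roots (isHermitian_conj_diagonal U d), roots_charpoly_conj_diagonal hU]
  simp

theorem entropy_diagonal (d : n → ℝ) :
    entropy (diagonal fun i => (d i : ℂ)) = ∑ i, entropyTerm (d i) := by
  simpa using entropy_conj_diagonal (U := (1 : Matrix n n ℂ)) (by simp) d

theorem entropy_submatrix_equiv {A : Matrix n n ℂ} (hA : A.IsHermitian) (e : m ≃ n) :
    entropy (A.submatrix e e) = entropy A := by
  rw [entropy_eq_sum_roots hA, entropy_eq_sum_roots (hA.submatrix e),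
    ← Matrix.charpoly_reindex e.symm A]
  rfl

/-- The two characteristic polynomials agree up to powers of X, and the additional zero roots
contribute `entropyTerm 0 = 0`. For pure bipartite states this is the equality of the two marginal
entropies. -/
theorem entropy_mul_conjTranspose_self (G : Matrix m n ℂ) :
    entropy (G * G.conjTranspose) = entropy (G.conjTranspose * G) := by
  rw [entropy_eq_sum_roots (isHermitian_mul_conjTranspose_self G),
    entropy_eq_sum_roots (isHermitian_conjTranspose_mul_self G)]
  have h := congrArg (fun q : Polynomial ℂ => (q.roots.map fun z => entropyTerm z.re).sum)
    (charpoly_mul_comm' G G.conjTranspose)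
  have hX (k : ℕ) : (Polynomial.X ^ k : Polynomial ℂ) ≠ 0 := pow_ne_zero _ Polynomial.X_ne_zero
  have h0 {q : Polynomial ℂ} (hq : q ≠ 0) (k : ℕ) :
      ((Polynomial.X ^ k * q).roots.map fun z : ℂ => entropyTerm z.re).sum
        = (q.roots.map fun z : ℂ => entropyTerm z.re).sum := by
    rw [Polynomial.roots_mul (mul_ne_zero (hX k) hq)]
    simp [Polynomial.roots_pow, Multiset.map_nsmul, Multiset.sum_nsmul]
  simpa only [h0 (charpoly_monic _).ne_zero] using h

theorem trace_conj_diagonal {U : Matrix n n ℂ} (hU : U.conjTranspose * U = 1) (d : n → ℝ) :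
    (U * diagonal (fun i => (d i : ℂ)) * U.conjTranspose).trace = ((∑ i, d i : ℝ) : ℂ) := by
  rw [Matrix.trace_mul_cycle, hU, Matrix.one_mul, trace_diagonal]
  simp

theorem entropy_blockDiagonal {M : m → Matrix n n ℂ} (hM : ∀ x, (M x).IsHermitian) :
    entropy (blockDiagonal M) = ∑ x, entropy (M x) := by
  choose U d hU _ hd _ using fun x => exists_diagonalization (hM x)
  have h : blockDiagonal M = blockDiagonal U * diagonal (fun i => ((d i.2 i.1 : ℝ) : ℂ)) *
      (blockDiagonal U).conjTranspose := by
    rw [← blockDiagonal_diagonal fun x i => (d x i : ℂ), blockDiagonal_conjTranspose, ←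
    blockDiagonal_mul,
      ← blockDiagonal_mul]
    exact congrArg _ (funext hd)
  have hB : (blockDiagonal U).conjTranspose * blockDiagonal U = 1 := by
    rw [blockDiagonal_conjTranspose, ← blockDiagonal_mul, funext hU]
    exact blockDiagonal_one
  rw [h, entropy_conj_diagonal hB, Fintype.sum_prod_type_right]
  refine Finset.sum_congr rfl fun x _ => ?_
  conv_rhs => rw [hd x, entropy_conj_diagonal (hU x)]

theorem entropy_kronecker {A : Matrix m m ℂ} {B : Matrix n n ℂ} (hA : A.IsHermitian)
    (hB : B.IsHermitian) :
    entropy (A ⊗ₖ B) = B.trace.re * entropy A + A.trace.re * entropy B := by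
  obtain ⟨U, d, hU, _, hd, _⟩ := exists_diagonalization hA
  obtain ⟨W, f, hW, _, hf, _⟩ := exists_diagonalization hB
  have h : A ⊗ₖ B = (U ⊗ₖ W) * diagonal (fun i => ((d i.1 * f i.2 : ℝ) : ℂ)) *
      (U ⊗ₖ W).conjTranspose := by
    conv_lhs => rw [hd, hf, mul_kronecker_mul, mul_kronecker_mul, diagonal_kronecker_diagonal,
      ← conjTranspose_kronecker]
    simp
  have hUW : (U ⊗ₖ W).conjTranspose * (U ⊗ₖ W) = 1 := by
    rw [conjTranspose_kronecker, ← mul_kronecker_mul, hU, hW, one_kronecker_one]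
  rw [h, entropy_conj_diagonal hUW, hd, hf, trace_conj_diagonal hU, trace_conj_diagonal hW,
    entropy_conj_diagonal hU, entropy_conj_diagonal hW, Fintype.sum_prod_type]
  simp only [entropyTerm_mul, Complex.ofReal_re, Finset.sum_add_distrib, Finset.sum_mul_sum]
  congr 1
  exact Finset.sum_comm

theorem entropy_smul {A : Matrix n n ℂ} (hA : A.IsHermitian) (c : ℝ) :
    entropy ((c : ℂ) • A) = A.trace.re * entropyTerm c + c * entropy A := by
  obtain ⟨U, d, hU, _, hd, _⟩ := exists_diagonalization hA
  have h : (c : ℂ) • A = U * diagonal (fun i => ((c * d i : ℝ) : ℂ)) * U.conjTranspose := by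
    conv_lhs => rw [hd, ← Matrix.smul_mul, ← Matrix.mul_smul, ← diagonal_smul]
    simp [Pi.smul_def]
  rw [h, entropy_conj_diagonal hU, hd, trace_conj_diagonal hU, entropy_conj_diagonal hU]
  simp only [entropyTerm_mul, Complex.ofReal_re, Finset.sum_add_distrib, Finset.sum_mul,
    Finset.mul_sum]

end Spectral

/-! ### Monotonicity of the relative entropy -/

section LogSums

open Filter Topology

variable {α : Type*} [Fintype α] {w l μ : α → ℝ}

/-- In the application `l` and `μ` are the eigenvalues of ρ and σ, and `w` holds the squared
overlaps of their eigenvectors. The derivative is then ⟨ρ, (L_σ + t R_ρ)⁻¹ ρ⟩. The convention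
`Real.log 0 = 0` does no harm, because `h0` kills the terms with `μ i = 0`. -/
theorem hasDerivAt_sum_log_add_mul (hl : ∀ i, 0 ≤ l i) (hμ : ∀ i, 0 ≤ μ i)
    (h0 : ∀ i, μ i = 0 → w i * l i = 0) {t : ℝ} (ht : 0 ≤ t) :
    HasDerivAt (fun t => ∑ i, w i * l i * (Real.log (μ i + t * l i) - Real.log (μ i)))
      (∑ i, w i * (l i ^ 2 / (μ i + t * l i))) t := by
  refine HasDerivAt.fun_sum fun i _ => ?_
  rcases eq_or_ne (w i * l i) 0 with h | h
  · have h2 : w i * (l i ^ 2 / (μ i + t * l i)) = 0 := by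
      rw [show w i * (l i ^ 2 / (μ i + t * l i)) = (w i * l i) * (l i / (μ i + t * l i)) by ring,
        h, zero_mul]
    simp only [h, h2, zero_mul]
    exact hasDerivAt_const _ _
  · have hm : 0 < μ i := lt_of_le_of_ne (hμ i) fun h' => h (h0 i h'.symm)
    have hp : μ i + t * l i ≠ 0 := (add_pos_of_pos_of_nonneg hm (mul_nonneg ht (hl i))).ne'
    have h1 : HasDerivAt (fun t => μ i + t * l i) (l i) t := by
      simpa using ((hasDerivAt_id t).mul_const (l i)).const_add (μ i)
    exact (((h1.log hp).sub_const (Real.log (μ i))).const_mul (w i * l i)).congr_deriv (by ring)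

/-- For t > 0, log(μ + t l) − log t = log(μ/t + l), which tends to log l when l > 0; terms with l =
0 carry weight zero. The limit is the relative entropy up to the factor log 2. -/
theorem tendsto_sum_log_add_mul (hl : ∀ i, 0 ≤ l i) :
    Tendsto (fun t => ∑ i, w i * l i * (Real.log (μ i + t * l i) - Real.log (μ i))
        - (∑ i, w i * l i) * Real.log t) atTop
      (𝓝 (∑ i, w i * l i * (Real.log (l i) - Real.log (μ i)))) := by
  have h : Tendsto (fun t => ∑ i, w i * l i *
      (Real.log (μ i / t + l i) - Real.log (μ i))) atTop
      (𝓝 (∑ i, w i * l i * (Real.log (l i) - Real.log (μ i)))) := by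
    refine tendsto_finsetSum _ fun i _ => ?_
    rcases eq_or_ne (l i) 0 with h | h
    · simp [h]
    · have h1 : Tendsto (fun t => μ i / t + l i) atTop (𝓝 (l i)) := by
        simpa using (tendsto_const_nhds.div_atTop tendsto_id).add_const (l i)
      exact ((h1.log h).sub_const _).const_mul _
  refine h.congr' ?_
  have hev : ∀ᶠ t : ℝ in atTop, ∀ i, l i ≠ 0 → 0 < μ i + t * l i := by
    rw [eventually_all]
    intro i
    rcases eq_or_ne (l i) 0 with h | h
    · simp [h]
    · have hp : 0 < l i := lt_of_le_of_ne (hl i) h.symm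
      filter_upwards [(tendsto_atTop_add_const_left atTop (μ i)
        (tendsto_id.atTop_mul_const hp)).eventually_gt_atTop 0] with t ht _
      exact ht
  filter_upwards [eventually_gt_atTop 0, hev] with t ht hpos
  rw [Finset.sum_mul, ← Finset.sum_sub_distrib]
  refine Finset.sum_congr rfl fun i _ => ?_
  rcases eq_or_ne (l i) 0 with h | h
  · simp [h]
  · rw [show μ i / t + l i = (μ i + t * l i) / t by field_simp,
      Real.log_div (hpos i h).ne' ht.ne']
    ring

/-- Both logarithmic sums vanish at t = 0, so the comparison of derivatives integrates to a
comparison for every t ≥ 0. By `htr` the same multiple of log t is subtracted on both sides before t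
tends to infinity. -/
theorem sum_mul_log_sub_log_le {β : Type*} [Fintype β] {w' l' μ' : β → ℝ}
    (hl : ∀ i, 0 ≤ l i) (hμ : ∀ i, 0 ≤ μ i) (h0 : ∀ i, μ i = 0 → w i * l i = 0)
    (hl' : ∀ i, 0 ≤ l' i) (hμ' : ∀ i, 0 ≤ μ' i) (h0' : ∀ i, μ' i = 0 → w' i * l' i = 0)
    (htr : ∑ i, w' i * l' i = ∑ i, w i * l i)
    (hle : ∀ t : ℝ, 0 < t →
      ∑ i, w' i * (l' i ^ 2 / (μ' i + t * l' i)) ≤ ∑ i, w i * (l i ^ 2 / (μ i + t * l i))) :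
    ∑ i, w' i * l' i * (Real.log (l' i) - Real.log (μ' i)) ≤
      ∑ i, w i * l i * (Real.log (l i) - Real.log (μ i)) := by
  set G := fun t : ℝ => ∑ i, w i * l i * (Real.log (μ i + t * l i) - Real.log (μ i))
  set G' := fun t : ℝ => ∑ i, w' i * l' i * (Real.log (μ' i + t * l' i) - Real.log (μ' i))
  have hd {t : ℝ} (ht : 0 ≤ t) := (hasDerivAt_sum_log_add_mul (w := w) hl hμ h0 ht).sub
    (hasDerivAt_sum_log_add_mul (w := w') hl' hμ' h0' ht)
  have hmono : MonotoneOn (G - G') (Set.Ici 0) := by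
    refine monotoneOn_of_deriv_nonneg (convex_Ici 0)
      (fun t ht => (hd ht).continuousAt.continuousWithinAt) ?_ ?_
    · intro t ht
      rw [interior_Ici] at ht
      exact (hd (le_of_lt ht)).differentiableAt.differentiableWithinAt
    · intro t ht
      rw [interior_Ici] at ht
      rw [(hd (le_of_lt ht)).deriv]
      exact sub_nonneg.2 (hle t ht)
  have hG {t : ℝ} (ht : 0 ≤ t) : G' t ≤ G t := by
    have := hmono (Set.mem_Ici.2 le_rfl) ht ht
    simpa [G, G'] using this
  refine le_of_tendsto_of_tendsto (tendsto_sum_log_add_mul (w := w') (μ := μ') hl')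
    (tendsto_sum_log_add_mul (w := w) (μ := μ) hl) ?_
  filter_upwards [eventually_ge_atTop 0] with t ht
  rw [htr]
  exact sub_le_sub_right (hG ht) _

/-- Termwise this is log x ≤ x − 1 at x = μ/l; it is the scalar content of Klein's inequality. -/
theorem sum_mul_sub_le_sum_mul_log_sub_log (hw : ∀ i, 0 ≤ w i) (hl : ∀ i, 0 ≤ l i)
    (hμ : ∀ i, 0 ≤ μ i) (h0 : ∀ i, μ i = 0 → w i * l i = 0) :
    ∑ i, w i * (l i - μ i) ≤ ∑ i, w i * l i * (Real.log (l i) - Real.log (μ i)) := by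
  refine Finset.sum_le_sum fun i _ => ?_
  rcases eq_or_ne (w i * l i) 0 with h | h
  · rw [mul_sub, h]
    have := mul_nonneg (hw i) (hμ i)
    simpa using this
  · have hm : 0 < μ i := lt_of_le_of_ne (hμ i) fun h' => h (h0 i h'.symm)
    have hp : 0 < l i := lt_of_le_of_ne (hl i) fun h' => h (by simp [← h'])
    have h1 := Real.log_le_sub_one_of_pos (div_pos hm hp)
    rw [Real.log_div hm.ne' hp.ne'] at h1
    have h2 : w i * (l i - μ i) = w i * l i * (1 - μ i / l i) := by field_simp
    rw [h2]
    exact mul_le_mul_of_nonneg_left (by linarith) (mul_nonneg (hw i) (hl i))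

end LogSums

/-! ### The resolvent quantity as a maximum of quadratic functionals. -/

section RelativeEntropy

variable {m n : Type*} [Fintype m] [DecidableEq m] [Fintype n] [DecidableEq n]

/-- The concave quadratic functional of `X` whose maximum is
`⟨ρ, (L_σ + t R_ρ)⁻¹ ρ⟩`, with `L` and `R` left and right multiplication. -/
def resolventFunctional (t : ℝ) (ρ σ X : Matrix n n ℂ) : ℝ :=
  2 * (X.conjTranspose * ρ).trace.re - (X * X.conjTranspose * σ).trace.re
    - t * (X.conjTranspose * X * ρ).trace.re

theorem re_trace_mul_diagonal (M : Matrix n n ℂ) (d : n → ℝ) :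
    (M * diagonal (fun i => (d i : ℂ))).trace.re = ∑ i, (M i i).re * d i := by
  simp [trace, mul_diagonal]

/-- When the trial operator is expressed in the eigenbases of σ (left) and ρ (right), the functional
decouples into independent scalar quadratics, one for each entry of `Y`. -/
theorem resolventFunctional_conj (t : ℝ) {U W : Matrix n n ℂ} (hU : U.conjTranspose * U = 1)
    (hW : W.conjTranspose * W = 1) (l μ : n → ℝ) (Y : Matrix n n ℂ) :
    resolventFunctional t (U * diagonal (fun i => (l i : ℂ)) * U.conjTranspose)
      (W * diagonal (fun i => (μ i : ℂ)) * W.conjTranspose) (W * Y * U.conjTranspose) =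
    ∑ i, ∑ j, (2 * (star (Y j i) * (W.conjTranspose * U) j i).re * l i
      - Complex.normSq (Y j i) * (μ j + t * l i)) := by
  set L := diagonal (fun i => (l i : ℂ))
  set D := diagonal (fun i => (μ i : ℂ))
  have h1 : ((W * Y * U.conjTranspose).conjTranspose * (U * L * U.conjTranspose)).trace =
      (Y.conjTranspose * (W.conjTranspose * U) * L).trace := by
    rw [show (W * Y * U.conjTranspose).conjTranspose * (U * L * U.conjTranspose) =
      U * (Y.conjTranspose * (W.conjTranspose * U) * L) * U.conjTranspose by
        simp only [conjTranspose_mul, conjTranspose_conjTranspose, Matrix.mul_assoc],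
      trace_mul_cycle, hU, Matrix.one_mul]
  have h2 : (W * Y * U.conjTranspose * (W * Y * U.conjTranspose).conjTranspose *
      (W * D * W.conjTranspose)).trace = (Y * Y.conjTranspose * D).trace := by
    rw [show W * Y * U.conjTranspose * (W * Y * U.conjTranspose).conjTranspose *
        (W * D * W.conjTranspose) = W * (Y * (U.conjTranspose * U) * Y.conjTranspose *
          (W.conjTranspose * W) * D) * W.conjTranspose by
        simp only [conjTranspose_mul, conjTranspose_conjTranspose, Matrix.mul_assoc],
      trace_mul_cycle, hU, hW, Matrix.one_mul, Matrix.mul_one, Matrix.mul_one]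
  have h3 : ((W * Y * U.conjTranspose).conjTranspose * (W * Y * U.conjTranspose) *
      (U * L * U.conjTranspose)).trace = (Y.conjTranspose * Y * L).trace := by
    rw [show (W * Y * U.conjTranspose).conjTranspose * (W * Y * U.conjTranspose) *
        (U * L * U.conjTranspose) = U * (Y.conjTranspose * (W.conjTranspose * W) * Y *
          (U.conjTranspose * U) * L) * U.conjTranspose by
        simp only [conjTranspose_mul, conjTranspose_conjTranspose, Matrix.mul_assoc],
      trace_mul_cycle, hU, hW, Matrix.one_mul, Matrix.mul_one, Matrix.mul_one]
  rw [resolventFunctional, h1, h2, h3]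
  have e1 : (Y.conjTranspose * (W.conjTranspose * U) * L).trace.re =
      ∑ i, ∑ j, (star (Y j i) * (W.conjTranspose * U) j i).re * l i := by
    simp only [L, re_trace_mul_diagonal, Matrix.mul_apply (M := Y.conjTranspose),
      conjTranspose_apply, Complex.re_sum, Finset.sum_mul]
  have e2 : (Y * Y.conjTranspose * D).trace.re = ∑ i, ∑ j, Complex.normSq (Y j i) * μ j := by
    rw [Finset.sum_comm]
    simp only [D, re_trace_mul_diagonal, Matrix.mul_apply, conjTranspose_apply, Complex.re_sum,
      Finset.sum_mul, Complex.star_def, Complex.mul_conj, Complex.ofReal_re]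
  have e3 : (Y.conjTranspose * Y * L).trace.re = ∑ i, ∑ j, Complex.normSq (Y j i) * l i := by
    simp only [L, re_trace_mul_diagonal, Matrix.mul_apply, conjTranspose_apply, Complex.re_sum,
      Finset.sum_mul, Complex.star_def, ← Complex.normSq_eq_conj_mul_self, Complex.ofReal_re]
  rw [e1, e2, e3, Finset.mul_sum, Finset.mul_sum, ← Finset.sum_sub_distrib,
    ← Finset.sum_sub_distrib]
  refine Finset.sum_congr rfl fun i _ => ?_
  rw [Finset.mul_sum, Finset.mul_sum, ← Finset.sum_sub_distrib, ← Finset.sum_sub_distrib]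
  exact Finset.sum_congr rfl fun j _ => by ring

theorem isGreatest_resolventFunctional {t : ℝ} (ht : 0 < t) {U W : Matrix n n ℂ}
    (hU : U.conjTranspose * U = 1) (hW : W.conjTranspose * W = 1) {l μ : n → ℝ}
    (hl : ∀ i, 0 ≤ l i) (hμ : ∀ i, 0 ≤ μ i) :
    IsGreatest (Set.range (resolventFunctional t
      (U * diagonal (fun i => (l i : ℂ)) * U.conjTranspose)
      (W * diagonal (fun i => (μ i : ℂ)) * W.conjTranspose)))
    (∑ p : n × n, Complex.normSq ((W.conjTranspose * U) p.2 p.1) *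
      (l p.1 ^ 2 / (μ p.2 + t * l p.1))) := by
  have hden (i j : n) : l i = 0 ∨ 0 < μ j + t * l i := by
    rcases (hl i).eq_or_lt with h | h
    · exact Or.inl h.symm
    · exact Or.inr (add_pos_of_nonneg_of_pos (hμ j) (mul_pos ht h))
  rw [Fintype.sum_prod_type]
  constructor
  -- Each scalar quadratic is maximized at overlap times l/(μ + t l). If the denominator vanishes
  -- then l = 0, and the entry is 0 as well.
  · refine ⟨W * (Matrix.of fun j i => ((l i / (μ j + t * l i) : ℝ) : ℂ) *
      (W.conjTranspose * U) j i) * U.conjTranspose, ?_⟩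
    rw [resolventFunctional_conj t hU hW]
    refine Finset.sum_congr rfl fun i _ => Finset.sum_congr rfl fun j _ => ?_
    simp only [of_apply]
    generalize (W.conjTranspose * U) j i = c
    rcases hden i j with h | h
    · simp [h]
    · have e : (star (((l i / (μ j + t * l i) : ℝ) : ℂ) * c) * c).re =
          l i / (μ j + t * l i) * Complex.normSq c := by
        rw [star_mul', mul_assoc, Complex.star_def, Complex.conj_ofReal, Complex.re_ofReal_mul,
          Complex.normSq_eq_conj_mul_self.symm, Complex.ofReal_re]
      rw [e, map_mul, Complex.normSq_ofReal]
      field_simp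
      ring
  · rintro _ ⟨X, rfl⟩
    have hU' := mul_eq_one_comm.1 hU
    have hW' := mul_eq_one_comm.1 hW
    have hX : X = W * (W.conjTranspose * X * U) * U.conjTranspose := by
      rw [← Matrix.mul_assoc, ← Matrix.mul_assoc, hW', Matrix.one_mul, Matrix.mul_assoc, hU',
        Matrix.mul_one]
    rw [hX, resolventFunctional_conj t hU hW]
    refine Finset.sum_le_sum fun i _ => Finset.sum_le_sum fun j _ => ?_
    generalize (W.conjTranspose * U) j i = c
    generalize (W.conjTranspose * X * U) j i = y
    rcases hden i j with h | h
    · simp only [h, mul_zero, add_zero]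
      have := mul_nonneg (Complex.normSq_nonneg y) (hμ j)
      simpa using this
    · generalize μ j + t * l i = s at h ⊢
      -- Completing the square: nonnegativity of |y s − l c|² is the required bound after division
      -- by s.
      have key : 0 ≤ Complex.normSq (y * (s : ℂ) - (l i : ℂ) * c) := Complex.normSq_nonneg _
      have e : Complex.normSq (y * (s : ℂ) - (l i : ℂ) * c) =
          s * (s * Complex.normSq y - 2 * (star y * c).re * l i) + l i ^ 2 * Complex.normSq c := by
        simp only [Complex.normSq_apply, Complex.star_def, Complex.sub_re, Complex.sub_im,
          Complex.mul_re, Complex.mul_im, Complex.ofReal_re, Complex.ofReal_im, Complex.conj_re,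
          Complex.conj_im]
        ring
      rw [e] at key
      have : Complex.normSq c * (l i ^ 2 / s) = l i ^ 2 * Complex.normSq c / s := by ring
      rw [this, le_div_iff₀ h]
      nlinarith [key]

end RelativeEntropy

/-! ### Channels and the variational functional. -/

section Channels

variable {A B : Type u} [Fintype A] [DecidableEq A] [Fintype B]
  {N : Matrix A A ℂ →ₗ[ℂ] Matrix B B ℂ}

theorem IsChannel.posSemidef (hN : IsChannel N) {ρ : Matrix A A ℂ} (hρ : ρ.PosSemidef) :
    (N ρ).PosSemidef := by
  obtain ⟨κ, _, K, _, h⟩ := hN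
  rw [h]
  exact posSemidef_sum _ fun k _ => hρ.mul_mul_conjTranspose_same _

theorem IsChannel.trace_apply (hN : IsChannel N) (ρ : Matrix A A ℂ) :
    (N ρ).trace = ρ.trace := by
  obtain ⟨κ, _, K, hK, h⟩ := hN
  rw [h, trace_sum]
  simp only [trace_mul_cycle (K _)]
  rw [← trace_sum, ← Matrix.sum_mul, hK, Matrix.one_mul]

theorem IsChannel.isDensity (hN : IsChannel N) {ρ : Matrix A A ℂ} (hρ : IsDensity ρ) :
    IsDensity (N ρ) :=
  ⟨hN.posSemidef hρ.1, by rw [hN.trace_apply, hρ.2]⟩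

/-- The Kadison–Schwarz inequality for the adjoint of a channel, tested against a positive
operator. -/
theorem kraus_kadison_schwarz {κ : Type*} [Fintype κ] [DecidableEq B] {K : κ → Matrix B A ℂ}
    (hK : ∑ k, (K k).conjTranspose * K k = 1) {ρ : Matrix A A ℂ} (hρ : ρ.PosSemidef)
    (X : Matrix B B ℂ) :
    ((∑ k, (K k).conjTranspose * X * K k).conjTranspose *
        (∑ k, (K k).conjTranspose * X * K k) * ρ).trace.re ≤
      (X.conjTranspose * X * ∑ k, K k * ρ * (K k).conjTranspose).trace.re := by
  set Z := ∑ k, (K k).conjTranspose * X * K k with hZ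
  have hZ' : Z.conjTranspose = ∑ k, (K k).conjTranspose * X.conjTranspose * K k := by
    simp only [hZ, conjTranspose_sum, conjTranspose_mul, conjTranspose_conjTranspose,
      Matrix.mul_assoc]
  -- Expanding this positive trace gives the claim: each cross term sums to −Tr(Z† Z ρ), and
  -- completeness of the Kraus operators turns the last term into +Tr(Z† Z ρ).
  have h0 : 0 ≤ (∑ k, ((X * K k - K k * Z) * ρ * (X * K k - K k * Z).conjTranspose)).trace :=
    (posSemidef_sum _ fun k _ => hρ.mul_mul_conjTranspose_same _).trace_nonneg
  have h1 : ∀ k, ((X * K k - K k * Z) * ρ * (X * K k - K k * Z).conjTranspose).trace =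
      (X.conjTranspose * X * (K k * ρ * (K k).conjTranspose)).trace
        - (Z.conjTranspose * ((K k).conjTranspose * X * K k) * ρ).trace
        - (((K k).conjTranspose * X.conjTranspose * K k) * Z * ρ).trace
        + (Z.conjTranspose * ((K k).conjTranspose * K k) * Z * ρ).trace := by
    intro k
    rw [trace_mul_comm, ← Matrix.mul_assoc, conjTranspose_sub, conjTranspose_mul,
      conjTranspose_mul, Matrix.sub_mul, Matrix.mul_sub, Matrix.mul_sub]
    simp only [Matrix.sub_mul, trace_sub]
    have e : (X.conjTranspose * X * (K k * ρ * (K k).conjTranspose)).trace =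
        ((K k).conjTranspose * X.conjTranspose * (X * K k) * ρ).trace := by
      rw [← Matrix.mul_assoc, trace_mul_comm]
      simp only [Matrix.mul_assoc]
    rw [e]
    simp only [Matrix.mul_assoc]
    ring
  rw [trace_sum, Finset.sum_congr rfl fun k _ => h1 k] at h0
  simp only [Finset.sum_add_distrib, Finset.sum_sub_distrib, ← trace_sum, ← Matrix.mul_sum,
    ← Matrix.sum_mul] at h0
  rw [← hZ', ← hZ, hK, Matrix.mul_one, sub_add_cancel] at h0
  have := (Complex.le_def.1 h0).1
  rw [Complex.sub_re] at this
  simpa using this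

/-- The witness is the adjoint channel applied to `X`. It leaves the linear term unchanged, and
Kadison–Schwarz, used for `X` with ρ and for `X†` with σ, does not let the subtracted quadratic
terms grow. -/
theorem IsChannel.resolventFunctional_le [DecidableEq B] (hN : IsChannel N) {t : ℝ} (ht : 0 ≤ t)
    {ρ σ : Matrix A A ℂ} (hρ : ρ.PosSemidef) (hσ : σ.PosSemidef) (X : Matrix B B ℂ) :
    ∃ Z, resolventFunctional t (N ρ) (N σ) X ≤ resolventFunctional t ρ σ Z := by
  obtain ⟨κ, _, K, hK, h⟩ := hN
  refine ⟨∑ k, (K k).conjTranspose * X * K k, ?_⟩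
  have hZ' : (∑ k, (K k).conjTranspose * X * K k).conjTranspose =
      ∑ k, (K k).conjTranspose * X.conjTranspose * K k := by
    simp only [conjTranspose_sum, conjTranspose_mul, conjTranspose_conjTranspose,
      Matrix.mul_assoc]
  have h1 : (X.conjTranspose * N ρ).trace =
      ((∑ k, (K k).conjTranspose * X * K k).conjTranspose * ρ).trace := by
    rw [hZ', h, Matrix.mul_sum, trace_sum, Matrix.sum_mul, trace_sum]
    refine Finset.sum_congr rfl fun k _ => ?_
    rw [← Matrix.mul_assoc, trace_mul_comm]
    simp only [Matrix.mul_assoc]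
  have h2 := kraus_kadison_schwarz hK hρ X
  have h3 := kraus_kadison_schwarz hK hσ X.conjTranspose
  rw [← hZ', conjTranspose_conjTranspose, conjTranspose_conjTranspose, ← h] at h3
  rw [← h] at h2
  rw [resolventFunctional, resolventFunctional, h1]
  have := mul_le_mul_of_nonneg_left h2 ht
  linarith

end Channels

/-! ### Klein's inequality and data processing. -/

section RelativeEntropy

variable {m n : Type*} [Fintype m] [DecidableEq m] [Fintype n] [DecidableEq n]

/-- The relative entropy `Tr ρ (log₂ ρ - log₂ σ)`, meaningful when the support of `ρ` is contained
in that of `σ`. -/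
def relEntropy (ρ σ : Matrix n n ℂ) : ℝ := -entropy ρ - (ρ * cfc (Real.logb 2) σ).trace.re

theorem conj_diag_re {U W : Matrix n n ℂ} (l : n → ℝ) (j : n) :
    ((W.conjTranspose * (U * diagonal (fun i => (l i : ℂ)) * U.conjTranspose) * W) j j).re =
      ∑ i, Complex.normSq ((W.conjTranspose * U) j i) * l i := by
  have h : W.conjTranspose * (U * diagonal (fun i => (l i : ℂ)) * U.conjTranspose) * W =
      (W.conjTranspose * U) * diagonal (fun i => (l i : ℂ)) *
        (W.conjTranspose * U).conjTranspose := by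
    simp only [conjTranspose_mul, conjTranspose_conjTranspose, Matrix.mul_assoc]
  rw [h, Matrix.mul_apply]
  simp only [mul_diagonal, conjTranspose_apply, Complex.re_sum]
  refine Finset.sum_congr rfl fun i _ => ?_
  rw [mul_right_comm, Complex.star_def, Complex.mul_conj, ← Complex.ofReal_mul,
    Complex.ofReal_re]

theorem re_trace_mul_conj_diagonal (ρ W : Matrix n n ℂ) (f : n → ℝ) :
    (ρ * (W * diagonal (fun i => (f i : ℂ)) * W.conjTranspose)).trace.re =
      ∑ j, ((W.conjTranspose * ρ * W) j j).re * f j := by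
  rw [← re_trace_mul_diagonal, ← Matrix.mul_assoc, trace_mul_comm]
  simp only [Matrix.mul_assoc]

theorem sum_normSq_col {C : Matrix n n ℂ} (hC : C.conjTranspose * C = 1) (i : n) :
    ∑ j, Complex.normSq (C j i) = 1 := by
  have h := congrArg (fun M => (M i i).re) hC
  simpa [Matrix.mul_apply, Complex.normSq_apply] using h

theorem overlap_unitary {U W : Matrix n n ℂ} (hU : U.conjTranspose * U = 1)
    (hW : W.conjTranspose * W = 1) :
    (W.conjTranspose * U).conjTranspose * (W.conjTranspose * U) = 1 := by
  rw [conjTranspose_mul, conjTranspose_conjTranspose, Matrix.mul_assoc,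
    ← Matrix.mul_assoc W, mul_eq_one_comm.1 hW, Matrix.one_mul, hU]

/-- The relative entropy in terms of eigenvalues and overlaps of eigenvectors. -/
theorem neg_sum_sub_sum_eq {U W : Matrix n n ℂ} (hU : U.conjTranspose * U = 1)
    (hW : W.conjTranspose * W = 1) (l μ : n → ℝ) :
    -∑ i, entropyTerm (l i) -
        ∑ j, (∑ i, Complex.normSq ((W.conjTranspose * U) j i) * l i) * Real.logb 2 (μ j) =
      (∑ p : n × n, Complex.normSq ((W.conjTranspose * U) p.2 p.1) * l p.1 *
        (Real.log (l p.1) - Real.log (μ p.2))) / Real.log 2 := by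
  have hC := sum_normSq_col (overlap_unitary hU hW)
  have h1 : ∑ i, entropyTerm (l i) =
      ∑ i, ∑ j, Complex.normSq ((W.conjTranspose * U) j i) * entropyTerm (l i) := by
    simp only [← Finset.sum_mul, hC, one_mul]
  have h2 : ∑ j, (∑ i, Complex.normSq ((W.conjTranspose * U) j i) * l i) * Real.logb 2 (μ j) =
      ∑ i, ∑ j, Complex.normSq ((W.conjTranspose * U) j i) * l i * Real.logb 2 (μ j) := by
    simp only [Finset.sum_mul]
    exact Finset.sum_comm
  rw [h1, h2, Fintype.sum_prod_type, Finset.sum_div, ← Finset.sum_neg_distrib,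
    ← Finset.sum_sub_distrib]
  refine Finset.sum_congr rfl fun i _ => ?_
  rw [Finset.sum_div, ← Finset.sum_neg_distrib, ← Finset.sum_sub_distrib]
  refine Finset.sum_congr rfl fun j _ => ?_
  simp only [entropyTerm, Real.logb]
  ring

/-- **Klein's inequality**, with the second operator given by its diagonalization. -/
theorem entropy_le_of_support {ρ W : Matrix n n ℂ} (hρ : ρ.PosSemidef)
    (hW : W.conjTranspose * W = 1) {μ : n → ℝ} (hμ : ∀ j, 0 ≤ μ j)
    (htr : ∑ j, μ j ≤ ρ.trace.re)
    (h0 : ∀ j, μ j = 0 → ((W.conjTranspose * ρ * W) j j).re = 0) :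
    entropy ρ ≤ -∑ j, ((W.conjTranspose * ρ * W) j j).re * Real.logb 2 (μ j) := by
  obtain ⟨U, l, hU, _, hd, hl, _⟩ := exists_diagonalization hρ.1
  replace hl := hl hρ
  have hC := overlap_unitary hU hW
  have hC' := overlap_unitary hW hU
  have hrow : ∀ j, ∑ i, Complex.normSq ((W.conjTranspose * U) j i) = 1 := by
    intro j
    rw [← sum_normSq_col hC' j]
    refine Finset.sum_congr rfl fun i _ => ?_
    rw [show (U.conjTranspose * W) i j = star ((W.conjTranspose * U) j i) by
      rw [← conjTranspose_apply, conjTranspose_mul, conjTranspose_conjTranspose]]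
    exact (Complex.normSq_conj _).symm
  have hent : entropy ρ = ∑ i, entropyTerm (l i) := by rw [hd, entropy_conj_diagonal hU]
  have htr' : ρ.trace.re = ∑ i, l i := by rw [hd, trace_conj_diagonal hU, Complex.ofReal_re]
  have hdiag : ∀ j, ((W.conjTranspose * ρ * W) j j).re =
      ∑ i, Complex.normSq ((W.conjTranspose * U) j i) * l i := by
    intro j
    rw [hd, conj_diag_re]
  have h := neg_sum_sub_sum_eq hU hW l μ
  have hk := sum_mul_sub_le_sum_mul_log_sub_log (α := n × n)
    (w := fun p => Complex.normSq ((W.conjTranspose * U) p.2 p.1)) (l := fun p => l p.1)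
    (μ := fun p => μ p.2) (fun _ => Complex.normSq_nonneg _) (fun _ => hl _) (fun _ => hμ _)
    (fun p hp => by
      have := h0 p.2 hp
      rw [hdiag] at this
      exact (Finset.sum_eq_zero_iff_of_nonneg fun i _ =>
        mul_nonneg (Complex.normSq_nonneg _) (hl i)).1 this p.1 (Finset.mem_univ _))
  -- The squared overlaps form a doubly stochastic matrix, so the weighted double sum collapses to a
  -- difference of traces.
  have hs : ∑ p : n × n, Complex.normSq ((W.conjTranspose * U) p.2 p.1) * (l p.1 - μ p.2) =
      ∑ i, l i - ∑ j, μ j := by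
    simp only [mul_sub, Finset.sum_sub_distrib]
    rw [Fintype.sum_prod_type, Fintype.sum_prod_type_right]
    simp only [← Finset.sum_mul, sum_normSq_col hC, hrow, one_mul]
  rw [hs] at hk
  have hnn := div_nonneg (le_trans (by linarith) hk) (Real.log_nonneg one_le_two)
  rw [← h] at hnn
  simp only [hdiag, hent]
  linarith

/-- On a kernel vector of σ, the inequality ρ ≤ σ forces the expectation of ρ to be zero; that
expectation is a sum of nonnegative terms, so each vanishes. -/
theorem support_of_le {ρ σ U W : Matrix n n ℂ} {l μ : n → ℝ} (hl : ∀ i, 0 ≤ l i)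
    (hρ : ρ = U * diagonal (fun i => (l i : ℂ)) * U.conjTranspose)
    (hW : W.conjTranspose * W = 1)
    (hσ : σ = W * diagonal (fun i => (μ i : ℂ)) * W.conjTranspose)
    (hle : (σ - ρ).PosSemidef) (i j : n) (hj : μ j = 0) :
    Complex.normSq ((W.conjTranspose * U) j i) * l i = 0 := by
  have h1 := (hle.conjTranspose_mul_mul_same W).diag_nonneg (i := j)
  have hσ' : W.conjTranspose * σ * W = diagonal fun i => (μ i : ℂ) := by
    rw [hσ, Matrix.mul_assoc W, ← Matrix.mul_assoc, hW, Matrix.one_mul, Matrix.mul_assoc, hW,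
      Matrix.mul_one]
  rw [Matrix.mul_sub, Matrix.sub_mul, hσ', Matrix.sub_apply, diagonal_apply_eq, hj] at h1
  have h2 := (Complex.le_def.1 h1).1
  rw [Complex.sub_re, hρ, conj_diag_re] at h2
  have h3 : ∑ i, Complex.normSq ((W.conjTranspose * U) j i) * l i = 0 :=
    le_antisymm (by simpa using h2)
      (Finset.sum_nonneg fun i _ => mul_nonneg (Complex.normSq_nonneg _) (hl i))
  exact (Finset.sum_eq_zero_iff_of_nonneg fun i _ =>
    mul_nonneg (Complex.normSq_nonneg _) (hl i)).1 h3 i (Finset.mem_univ _)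

/-- The **data-processing inequality** for the relative entropy. -/
theorem IsChannel.relEntropy_le {A B : Type u} [Fintype A] [DecidableEq A] [Fintype B]
    [DecidableEq B] {N : Matrix A A ℂ →ₗ[ℂ] Matrix B B ℂ} (hN : IsChannel N)
    {ρ σ : Matrix A A ℂ} (hρ : ρ.PosSemidef) (hσ : σ.PosSemidef) (hle : (σ - ρ).PosSemidef) :
    relEntropy (N ρ) (N σ) ≤ relEntropy ρ σ := by
  have hle' : (N σ - N ρ).PosSemidef := by
    rw [← map_sub]
    exact hN.posSemidef hle
  obtain ⟨U, l, hU, _, hd, hl, _⟩ := exists_diagonalization hρ.1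
  obtain ⟨W, μ, hW, _, he, hμ, hf⟩ := exists_diagonalization hσ.1
  obtain ⟨U', l', hU', _, hd', hl', _⟩ := exists_diagonalization (hN.posSemidef hρ).1
  obtain ⟨W', μ', hW', _, he', hμ', hf'⟩ := exists_diagonalization (hN.posSemidef hσ).1
  replace hl := hl hρ
  replace hμ := hμ hσ
  replace hl' := hl' (hN.posSemidef hρ)
  replace hμ' := hμ' (hN.posSemidef hσ)
  have e1 : relEntropy ρ σ = (∑ p : A × A, Complex.normSq ((W.conjTranspose * U) p.2 p.1) *
      l p.1 * (Real.log (l p.1) - Real.log (μ p.2))) / Real.log 2 := by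
    rw [← neg_sum_sub_sum_eq hU hW, relEntropy, hf, hd, entropy_conj_diagonal hU,
      re_trace_mul_conj_diagonal]
    simp only [conj_diag_re]
  have e2 : relEntropy (N ρ) (N σ) =
      (∑ p : B × B, Complex.normSq ((W'.conjTranspose * U') p.2 p.1) *
        l' p.1 * (Real.log (l' p.1) - Real.log (μ' p.2))) / Real.log 2 := by
    rw [← neg_sum_sub_sum_eq hU' hW', relEntropy, hf', hd', entropy_conj_diagonal hU',
      re_trace_mul_conj_diagonal]
    simp only [conj_diag_re]
  rw [e1, e2]
  refine div_le_div_of_nonneg_right ?_ (Real.log_nonneg one_le_two)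
  refine sum_mul_log_sub_log_le (α := A × A) (β := B × B)
    (w := fun p => Complex.normSq ((W.conjTranspose * U) p.2 p.1)) (l := fun p => l p.1)
    (μ := fun p => μ p.2) (w' := fun p => Complex.normSq ((W'.conjTranspose * U') p.2 p.1))
    (l' := fun p => l' p.1) (μ' := fun p => μ' p.2) (fun _ => hl _) (fun _ => hμ _)
    (fun p => support_of_le hl hd hW he hle p.1 p.2) (fun _ => hl' _) (fun _ => hμ' _)
    (fun p => support_of_le hl' hd' hW' he' hle' p.1 p.2) ?_ ?_
  · rw [Fintype.sum_prod_type, Fintype.sum_prod_type]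
    simp only [← Finset.sum_mul, sum_normSq_col (overlap_unitary hU hW),
      sum_normSq_col (overlap_unitary hU' hW'), one_mul]
    have h := hN.trace_apply ρ
    rw [hd', hd, trace_conj_diagonal hU', trace_conj_diagonal hU] at h
    exact_mod_cast h
  · intro t ht
    -- The maximizer on the output side is pulled back to a trial operator on the input side, whose
    -- value is bounded by the maximum there.
    obtain ⟨⟨X, hX⟩, -⟩ := isGreatest_resolventFunctional ht hU' hW' hl' hμ'
    obtain ⟨-, hub⟩ := isGreatest_resolventFunctional ht hU hW hl hμ
    obtain ⟨Z, hZ⟩ := hN.resolventFunctional_le ht.le hρ hσ X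
    rw [← hX]
    refine le_trans ?_ (hub ⟨Z, rfl⟩)
    rw [← hd, ← he, ← hd', ← he']
    exact hZ

/-- The **data-processing inequality** for the Holevo quantity of a family of positive
operators. -/
theorem IsChannel.entropy_sum_sub_le {A B Y : Type u} [Fintype A] [DecidableEq A] [Fintype B]
    [DecidableEq B] [Fintype Y] {N : Matrix A A ℂ →ₗ[ℂ] Matrix B B ℂ} (hN : IsChannel N)
    {M : Y → Matrix A A ℂ} (hM : ∀ y, (M y).PosSemidef) :
    entropy (N (∑ y, M y)) - ∑ y, entropy (N (M y)) ≤ entropy (∑ y, M y) - ∑ y, entropy (M y) := by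
  classical
  -- The cross terms Tr(R_y log ΣR) add up to Tr(ΣR log ΣR), so the Holevo-type difference is a sum
  -- of relative entropies to the total.
  have key {C : Type u} [Fintype C] [DecidableEq C] (R : Y → Matrix C C ℂ) :
      ∑ y, relEntropy (R y) (∑ y, R y) = entropy (∑ y, R y) - ∑ y, entropy (R y) := by
    simp only [relEntropy, Finset.sum_sub_distrib, Finset.sum_neg_distrib, ← Complex.re_sum,
      ← trace_sum, ← Matrix.sum_mul]
    rw [entropy]
    ring
  have h := Finset.sum_le_sum fun y (_ : y ∈ Finset.univ) =>
    -- Each member of the family is dominated by the total, which supplies the support condition.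
    hN.relEntropy_le (hM y) (posSemidef_sum Finset.univ fun y _ => hM y) (by
      rw [← Finset.add_sum_erase _ _ (Finset.mem_univ y), add_sub_cancel_left]
      exact posSemidef_sum _ fun y _ => hM y)
  rw [key, map_sum, key] at h
  rwa [map_sum]

end RelativeEntropy

/-! ### Continuity of the entropy and compactness of convex hulls -/

section Continuity

variable {n : Type*} [Fintype n] [DecidableEq n]

theorem entropy_eq_trace_cfc {A : Matrix n n ℂ} (hA : A.IsHermitian) :
    entropy A = (cfc entropyTerm A).trace.re := by
  obtain ⟨U, d, hU, _, hd, _, hf⟩ := exists_diagonalization hA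
  rw [hf]
  conv_lhs => rw [hd]
  rw [entropy_conj_diagonal hU, trace_conj_diagonal hU, Complex.ofReal_re]

theorem IsDensity.spectrum_subset {A : Matrix n n ℂ} (hA : IsDensity A) :
    spectrum ℝ A ⊆ Set.Icc 0 1 := by
  obtain ⟨hA, htr⟩ := hA
  rw [hA.1.spectrum_real_eq_range_eigenvalues]
  rintro _ ⟨i, rfl⟩
  refine ⟨hA.eigenvalues_nonneg i, ?_⟩
  have h := hA.1.trace_eq_sum_eigenvalues.symm.trans htr
  have h' : ∑ i, hA.1.eigenvalues i = 1 :=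
    Complex.ofReal_injective (by push_cast; exact h)
  rw [← h']
  exact Finset.single_le_sum (fun i _ => hA.eigenvalues_nonneg i) (Finset.mem_univ i)

-- The operator norm makes matrices a C*-algebra, where the functional calculus of a fixed
-- continuous function is continuous on self-adjoint elements with spectrum in a fixed compact set;
-- here [0, 1].
open scoped Matrix.Norms.L2Operator in
theorem continuousOn_entropy_l2 :
    ContinuousOn (entropy : Matrix n n ℂ → ℝ) {A | IsDensity A} := by
  have h := (continuousOn_cfc (Matrix n n ℂ) (p := IsSelfAdjoint)
    (isCompact_Icc (a := (0 : ℝ)) (b := 1)) entropyTerm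
    continuous_entropyTerm.continuousOn).mono (t := {A : Matrix n n ℂ | IsDensity A})
    (fun A (hA : IsDensity A) => ⟨hA.1.1, hA.spectrum_subset⟩)
  have h2 : Continuous fun M : Matrix n n ℂ => M.trace.re := by fun_prop
  exact (h2.comp_continuousOn h).congr fun A (hA : IsDensity A) => entropy_eq_trace_cfc hA.1.1

theorem continuousOn_entropy :
    ContinuousOn (entropy : Matrix n n ℂ → ℝ) {A | IsDensity A} :=
  continuousOn_entropy_l2

end Continuity

/-- By Carathéodory, at most dim + 1 points are needed, so the hull is a finite union of continuous
images of a simplex times a power of `s`. -/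
theorem _root_.IsCompact.convexHull_of_finiteDimensional {E : Type*} [AddCommGroup E]
    [Module ℝ E] [TopologicalSpace E] [ContinuousAdd E] [ContinuousSMul ℝ E]
    [FiniteDimensional ℝ E] {s : Set E} (hs : IsCompact s) : IsCompact (convexHull ℝ s) := by
  have h : convexHull ℝ s = ⋃ k ∈ Finset.range (Module.finrank ℝ E + 2),
      (fun q : (Fin k → ℝ) × (Fin k → E) => ∑ i, q.1 i • q.2 i) ''
        (stdSimplex ℝ (Fin k) ×ˢ Set.univ.pi fun _ => s) := by
    apply Set.Subset.antisymm
    · intro x hx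
      obtain ⟨ι, _, z, w, hz, hi, hw, hw1, rfl⟩ := eq_pos_convex_span_of_mem_convexHull hx
      let e := (Fintype.equivFin ι).symm
      refine Set.mem_biUnion (x := Fintype.card ι) ?_ ⟨(w ∘ e, z ∘ e), ⟨⟨?_, ?_⟩, ?_⟩, ?_⟩
      · have h1 := hi.card_le_finrank_succ
        have h2 := Submodule.finrank_le (vectorSpan ℝ (Set.range z))
        exact Finset.mem_coe.2 (Finset.mem_range.2 (by omega))
      · exact fun i => (hw _).le
      · simpa using (e.sum_comp w).trans hw1
      · exact fun i _ => hz (Set.mem_range_self _)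
      · exact e.sum_comp fun i => w i • z i
    · refine Set.iUnion₂_subset fun k _ => ?_
      rintro _ ⟨⟨w, z⟩, ⟨hw, hz⟩, rfl⟩
      exact (convex_convexHull ℝ s).sum_mem (fun i _ => hw.1 i) hw.2
        fun i _ => subset_convexHull ℝ s (hz i (Set.mem_univ i))
  rw [h]
  refine Finset.isCompact_biUnion _ fun k _ => IsCompact.image
    ((isCompact_stdSimplex ℝ (Fin k)).prod (isCompact_univ_pi fun _ => hs)) ?_
  exact continuous_finsetSum _ fun i _ =>
    ((continuous_apply i).comp continuous_fst).smul ((continuous_apply i).comp continuous_snd)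

/-! ### Partial traces and product operators -/

section PartialTrace

variable {m n : Type*}

/-- Product operators span the operators on a composite system, so identities linear in ρ need
checking only on them. -/
theorem kronecker_induction [Fintype m] [Fintype n] [DecidableEq m] [DecidableEq n]
    {P : Matrix (m × n) (m × n) ℂ → Prop} (h0 : P 0)
    (hadd : ∀ ρ σ, P ρ → P σ → P (ρ + σ))
    (hk : ∀ (X : Matrix m m ℂ) (Y : Matrix n n ℂ), P (X ⊗ₖ Y)) (ρ : Matrix (m × n) (m × n) ℂ) :
    P ρ := by
  rw [matrix_eq_sum_single ρ]
  refine Finset.sum_induction _ P hadd h0 fun i _ =>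
    Finset.sum_induction _ P hadd h0 fun j _ => ?_
  have h : single i j (ρ i j) = (single i.1 j.1 (ρ i j)) ⊗ₖ (single i.2 j.2 (1 : ℂ)) := by
    rw [single_kronecker_single, mul_one]
  rw [h]
  exact hk _ _

/-- `traceLeft` as a linear map. -/
def traceLeftMap [Fintype m] : Matrix (m × n) (m × n) ℂ →ₗ[ℂ] Matrix n n ℂ where
  toFun := traceLeft
  map_add' ρ σ := by ext; simp [traceLeft, Finset.sum_add_distrib]
  map_smul' c ρ := by ext; simp [traceLeft, Finset.mul_sum]

/-- `traceRight` as a linear map. -/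
def traceRightMap [Fintype n] : Matrix (m × n) (m × n) ℂ →ₗ[ℂ] Matrix m m ℂ where
  toFun := traceRight
  map_add' ρ σ := by ext; simp [traceRight, Finset.sum_add_distrib]
  map_smul' c ρ := by ext; simp [traceRight, Finset.mul_sum]

theorem traceLeftMap_apply [Fintype m] (ρ : Matrix (m × n)
    (m × n) ℂ) : traceLeftMap ρ = traceLeft ρ := rfl

theorem traceRightMap_apply [Fintype n] (ρ : Matrix (m × n)
    (m × n) ℂ) : traceRightMap ρ = traceRight ρ := rfl

theorem traceLeft_kronecker [Fintype m] (X : Matrix m m ℂ) (Y : Matrix n n ℂ) :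
    traceLeft (X ⊗ₖ Y) = X.trace • Y := by
  ext
  simp [traceLeft, trace, Finset.sum_mul]

theorem traceRight_kronecker [Fintype n] (X : Matrix m m ℂ) (Y : Matrix n n ℂ) :
    traceRight (X ⊗ₖ Y) = Y.trace • X := by
  ext
  simp [traceRight, trace, ← Finset.mul_sum, mul_comm]

theorem traceRight_eq_traceLeft_swap [Fintype n] (ρ : Matrix (m × n) (m × n) ℂ) :
    traceRight ρ = traceLeft (ρ.submatrix (Equiv.prodComm n m) (Equiv.prodComm n m)) := rfl

theorem trace_traceLeft [Fintype m] [Fintype n] (ρ : Matrix (m × n)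
    (m × n) ℂ) : (traceLeft ρ).trace = ρ.trace := by
  simp only [trace, traceLeft, diag_apply, of_apply, Fintype.sum_prod_type]
  exact Finset.sum_comm

theorem trace_traceRight [Fintype m] [Fintype n] (ρ : Matrix (m × n)
    (m × n) ℂ) : (traceRight ρ).trace = ρ.trace := by
  simp only [trace, traceRight, diag_apply, of_apply, Fintype.sum_prod_type]

theorem posSemidef_traceLeft [Fintype m] {ρ : Matrix (m × n) (m × n) ℂ} (hρ : ρ.PosSemidef) :
    (traceLeft ρ).PosSemidef := by
  have h : traceLeft ρ = ∑ i, ρ.submatrix (fun j => (i, j)) (fun j => (i, j)) := by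
    ext
    simp [traceLeft, Matrix.sum_apply]
  rw [h]
  exact posSemidef_sum _ fun i _ => hρ.submatrix _

theorem posSemidef_traceRight [Fintype n] {ρ : Matrix (m × n) (m × n) ℂ} (hρ : ρ.PosSemidef) :
    (traceRight ρ).PosSemidef := by
  rw [traceRight_eq_traceLeft_swap]
  exact posSemidef_traceLeft (hρ.submatrix _)

theorem traceRight_kronecker_conj [Fintype m] [Fintype n] [DecidableEq m] [DecidableEq n] {U :
    Matrix m m ℂ}
    {W : Matrix n n ℂ} (hW : W * W.conjTranspose = 1) (ρ : Matrix (m × n) (m × n) ℂ) :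
    traceRight ((U ⊗ₖ W).conjTranspose * ρ * (U ⊗ₖ W)) =
      U.conjTranspose * traceRight ρ * U := by
  induction ρ using kronecker_induction with
  | h0 => simp [← traceRightMap_apply]
  | hadd ρ σ h1 h2 =>
    simp only [← traceRightMap_apply, Matrix.mul_add, Matrix.add_mul, map_add] at *
    rw [h1, h2]
  | hk X Y =>
    rw [conjTranspose_kronecker, ← mul_kronecker_mul, ← mul_kronecker_mul, traceRight_kronecker,
      traceRight_kronecker, trace_mul_cycle, hW, Matrix.one_mul, Matrix.mul_smul, Matrix.smul_mul]

theorem traceLeft_kronecker_conj [Fintype m] [Fintype n] [DecidableEq m] [DecidableEq n] {U :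
    Matrix m m ℂ}
    {W : Matrix n n ℂ} (hU : U * U.conjTranspose = 1) (ρ : Matrix (m × n) (m × n) ℂ) :
    traceLeft ((U ⊗ₖ W).conjTranspose * ρ * (U ⊗ₖ W)) =
      W.conjTranspose * traceLeft ρ * W := by
  induction ρ using kronecker_induction with
  | h0 => simp [← traceLeftMap_apply]
  | hadd ρ σ h1 h2 =>
    simp only [← traceLeftMap_apply, Matrix.mul_add, Matrix.add_mul, map_add] at *
    rw [h1, h2]
  | hk X Y =>
    rw [conjTranspose_kronecker, ← mul_kronecker_mul, ← mul_kronecker_mul, traceLeft_kronecker,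
      traceLeft_kronecker, trace_mul_cycle, hU, Matrix.one_mul, Matrix.mul_smul, Matrix.smul_mul]

theorem isChannel_traceLeft {m n : Type u} [Fintype m] [Fintype n] [DecidableEq m]
    [DecidableEq n] : IsChannel (traceLeftMap : Matrix (m × n) (m × n) ℂ →ₗ[ℂ] Matrix n n ℂ) := by
  refine ⟨m, inferInstance, fun i => of fun b p => if p = (i, b) then 1 else 0, ?_, fun ρ => ?_⟩
  · ext p q
    simp only [Matrix.sum_apply, Matrix.mul_apply, conjTranspose_apply, of_apply, one_apply]
    rw [← Fintype.sum_prod_type (f := fun r : m × n =>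
      star (if p = r then (1 : ℂ) else 0) * if q = r then 1 else 0)]
    simp
  · ext b b'
    simp [traceLeftMap_apply, traceLeft, Matrix.sum_apply, Matrix.mul_apply]

theorem conj_conj_diagonal [Fintype n] [DecidableEq n] {V : Matrix n n ℂ}
    (hV : V.conjTranspose * V = 1) (c : n → ℂ) :
    V.conjTranspose * (V * diagonal c * V.conjTranspose) * V = diagonal c := by
  rw [Matrix.mul_assoc V, ← Matrix.mul_assoc, hV, Matrix.one_mul, Matrix.mul_assoc, hV,
    Matrix.mul_one]

/-- **Subadditivity** of the entropy. -/
theorem entropy_le_traceRight_add_traceLeft [Fintype m] [Fintype n] [DecidableEq m] [DecidableEq n]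
    {ρ : Matrix (m × n) (m × n) ℂ} (hρ : IsDensity ρ) :
    entropy ρ ≤ entropy (traceRight ρ) + entropy (traceLeft ρ) := by
  obtain ⟨hρ, htr⟩ := hρ
  have h1 := posSemidef_traceRight hρ
  have h2 := posSemidef_traceLeft hρ
  obtain ⟨U, a, hU, hU', hd, ha, _⟩ := exists_diagonalization h1.1
  obtain ⟨W, b, hW, hW', he, hb, _⟩ := exists_diagonalization h2.1
  replace ha := ha h1
  replace hb := hb h2
  have hUW : (U ⊗ₖ W).conjTranspose * (U ⊗ₖ W) = 1 := by
    rw [conjTranspose_kronecker, ← mul_kronecker_mul, hU, hW, one_kronecker_one]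
  set R := (U ⊗ₖ W).conjTranspose * ρ * (U ⊗ₖ W) with hR
  have hRp : R.PosSemidef := hρ.conjTranspose_mul_mul_same _
  have hnn (p) : 0 ≤ (R p p).re := (Complex.le_def.1 (hRp.diag_nonneg (i := p))).1
  have hA (i) : ∑ j, (R (i, j) (i, j)).re = a i := by
    have h := traceRight_kronecker_conj (U := U) hW' ρ
    rw [hd, conj_conj_diagonal hU] at h
    simpa [traceRight] using congrArg (fun M => (M i i).re) h
  have hB (j) : ∑ i, (R (i, j) (i, j)).re = b j := by
    have h := traceLeft_kronecker_conj (W := W) hU' ρ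
    rw [he, conj_conj_diagonal hW] at h
    simpa [traceLeft] using congrArg (fun M => (M j j).re) h
  have ha1 : ∑ i, a i = 1 := by
    have h := trace_traceRight ρ
    rw [hd, trace_conj_diagonal hU, htr] at h
    exact_mod_cast h
  have hb1 : ∑ i, b i = 1 := by
    have h := trace_traceLeft ρ
    rw [he, trace_conj_diagonal hW, htr] at h
    exact_mod_cast h
  have hz1 (i j) (h : a i = 0) : (R (i, j) (i, j)).re = 0 :=
    (Finset.sum_eq_zero_iff_of_nonneg fun j _ => hnn (i, j)).1 ((hA i).trans h) j
      (Finset.mem_univ j)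
  have hz2 (i j) (h : b j = 0) : (R (i, j) (i, j)).re = 0 :=
    (Finset.sum_eq_zero_iff_of_nonneg fun i _ => hnn (i, j)).1 ((hB j).trans h) i
      (Finset.mem_univ i)
  -- Klein's inequality against the product of the two marginals, whose eigenvalues in the basis `U
  -- ⊗ₖ W` are a_i b_j.
  have key := entropy_le_of_support hρ hUW (μ := fun p => a p.1 * b p.2)
    (fun p => mul_nonneg (ha _) (hb _))
    (by rw [htr, Fintype.sum_prod_type]; simp [← Finset.mul_sum, ha1, hb1])
    (fun p hp => (mul_eq_zero.1 hp).elim (hz1 p.1 p.2) (hz2 p.1 p.2))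
  rw [← hR] at key
  refine key.trans_eq ?_
  rw [hd, he, entropy_conj_diagonal hU, entropy_conj_diagonal hW]
  have hs : ∑ p : m × n, (R p p).re * Real.logb 2 (a p.1 * b p.2) =
      ∑ i, ∑ j, ((R (i, j) (i, j)).re * Real.logb 2 (a i) +
        (R (i, j) (i, j)).re * Real.logb 2 (b j)) := by
    rw [Fintype.sum_prod_type]
    refine Finset.sum_congr rfl fun i _ => Finset.sum_congr rfl fun j _ => ?_
    by_cases h1 : a i = 0
    · simp [hz1 i j h1]
    by_cases h2 : b j = 0
    · simp [hz2 i j h2]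
    rw [Real.logb_mul h1 h2, mul_add]
  rw [hs]
  simp only [Finset.sum_add_distrib, ← Finset.sum_mul, hA]
  rw [Finset.sum_comm]
  simp only [← Finset.sum_mul, hB, entropyTerm, Finset.sum_neg_distrib]
  ring

end PartialTrace

/-! ### Classical-quantum states -/

section Holevo

variable {X Y B : Type*} [Fintype X] [DecidableEq X] [Fintype Y] [DecidableEq Y] [Fintype B]
  [DecidableEq B]

/-- The Holevo quantity of the family of positive operators `M x = p x • ρ x`, in a form that makes
sense without normalization. -/
def holevoInfo (M : X → Matrix B B ℂ) : ℝ :=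
  (entropy (∑ x, M x) - ∑ x, entropy (M x)) -
    (entropyTerm (∑ x, M x).trace.re - ∑ x, entropyTerm (M x).trace.re)

omit [DecidableEq B] in
theorem _root_.Matrix.PosSemidef.ofReal_re_trace {M : Matrix B B ℂ} (hM : M.PosSemidef) :
    ((M.trace.re : ℝ) : ℂ) = M.trace :=
  Complex.ext rfl (Complex.le_def.1 hM.trace_nonneg).2

omit [Fintype B] [DecidableEq B] in
theorem traceLeft_submatrix_blockDiagonal (M : X → Matrix B B ℂ) :
    traceLeft ((blockDiagonal M).submatrix (Equiv.prodComm X B) (Equiv.prodComm X B)) =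
      ∑ x, M x := by
  ext
  simp [traceLeft, Matrix.sum_apply]

omit [Fintype X] [DecidableEq B] in
theorem traceRight_submatrix_blockDiagonal (M : X → Matrix B B ℂ) (hM : ∀ x, (M x).PosSemidef) :
    traceRight ((blockDiagonal M).submatrix (Equiv.prodComm X B) (Equiv.prodComm X B)) =
      diagonal fun x => (((M x).trace.re : ℝ) : ℂ) := by
  ext x x'
  simp only [traceRight, of_apply, submatrix_apply, Equiv.prodComm_apply, Prod.swap_prod_mk,
    blockDiagonal_apply, diagonal_apply]
  split_ifs with h
  · subst h
    rw [(hM x).ofReal_re_trace]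
    rfl
  · simp

theorem mutualInfo_blockDiagonal {M : X → Matrix B B ℂ} (hM : ∀ x, (M x).PosSemidef)
    (htr : (∑ x, M x).trace = 1) :
    mutualInfo ((blockDiagonal M).submatrix (Equiv.prodComm X B) (Equiv.prodComm X B)) =
      holevoInfo M := by
  have hb : (blockDiagonal M).IsHermitian := by
    rw [IsHermitian, blockDiagonal_conjTranspose]
    exact congrArg _ (funext fun x => (hM x).1)
  rw [mutualInfo, traceLeft_submatrix_blockDiagonal, traceRight_submatrix_blockDiagonal M hM,
    entropy_submatrix_equiv hb, entropy_diagonal, entropy_blockDiagonal fun x => (hM x).1,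
    holevoInfo, htr]
  simp
  ring

/-- The reordering of indices `(y, b, x) ↦ (b, (y, x))`. -/
def prodRotate (Y B X : Type*) : Y × B × X ≃ B × (Y × X) :=
  (Equiv.prodAssoc Y B X).symm.trans
    (((Equiv.prodComm Y B).prodCongr (Equiv.refl X)).trans (Equiv.prodAssoc B Y X))

/-- Working with unnormalized families absorbs the weights of x, so no division by a possibly zero
probability occurs: H(X) supplies the Shannon terms of the individual x. -/
theorem condMutualInfo_blockDiagonal {M : Y → X → Matrix B B ℂ}
    (hM : ∀ y x, (M y x).PosSemidef) :
    condMutualInfo ((blockDiagonal fun q : Y × X => M q.1 q.2).submatrix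
      (prodRotate Y B X) (prodRotate Y B X)) = ∑ x, holevoInfo fun y => M y x := by
  set R := (blockDiagonal fun q : Y × X => M q.1 q.2).submatrix
      (prodRotate Y B X) (prodRotate Y B X) with hR
  have hb : (blockDiagonal fun q : Y × X => M q.1 q.2).IsHermitian := by
    rw [IsHermitian, blockDiagonal_conjTranspose]
    exact congrArg _ (funext fun q => (hM q.1 q.2).1)
  have h1 : traceMiddle R = diagonal fun q : Y × X => (((M q.1 q.2).trace.re : ℝ) : ℂ) := by
    rw [← traceRight_submatrix_blockDiagonal (fun q : Y × X => M q.1 q.2) fun q => hM q.1 q.2]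
    rfl
  have h2 : traceLeft R = blockDiagonal fun x => ∑ y, M y x := by
    ext ⟨b, x⟩ ⟨b', x'⟩
    simp only [hR, traceLeft, of_apply, submatrix_apply, prodRotate, blockDiagonal_apply]
    by_cases h : x = x'
    · simp [h, Matrix.sum_apply]
    · simp [h]
  have hp (x) : (∑ y, M y x).PosSemidef := posSemidef_sum _ fun y _ => hM y x
  have h3 : traceLeft (traceLeft R) =
      diagonal fun x => (((∑ y, M y x).trace.re : ℝ) : ℂ) := by
    rw [h2, ← traceRight_submatrix_blockDiagonal (fun x => ∑ y, M y x) hp]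
    rfl
  rw [condMutualInfo, h3, h2, h1, entropy_diagonal, entropy_diagonal,
    entropy_blockDiagonal fun x => (hp x).1, hR, entropy_submatrix_equiv hb,
    entropy_blockDiagonal fun q : Y × X => (hM q.1 q.2).1, Fintype.sum_prod_type_right,
    Fintype.sum_prod_type_right]
  simp only [holevoInfo, Finset.sum_sub_distrib]
  ring

end Holevo

/-! ### Marginals of the private state as block-diagonal matrices. -/

section PrivateState

variable {A B E X Y : Type u} [Fintype A] [Fintype X] [DecidableEq X]
  [Fintype Y] [DecidableEq Y] (p : X × Y → ℝ) (ρ : X → Y → Matrix A A ℂ) (V : Matrix (B × E) A ℂ)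

theorem privateState_apply (x x' : X) (y y' : Y) (i i' : B × E) :
    privateState p ρ V (x, y, i) (x', y', i') =
      if (y, x) = (y', x') then (p (x, y) : ℂ) * (V * ρ x y * V.conjTranspose) i i' else 0 := by
  simp only [privateState, Matrix.sum_apply, Matrix.smul_apply, kroneckerMap_apply, single_apply,
    smul_eq_mul, Prod.mk.injEq]
  by_cases hx : x = x'
  · subst hx
    by_cases hy : y = y'
    · subst hy
      rw [Finset.sum_eq_single x, Finset.sum_eq_single y]
      · simp
      · intro b _ hb
        simp [hb]
      · simp
      · intro b _ hb
        simp [hb]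
      · simp
    · rw [if_neg (by tauto)]
      refine Finset.sum_eq_zero fun a _ => Finset.sum_eq_zero fun b _ => ?_
      rw [if_neg (c := b = y ∧ b = y') (by rintro ⟨rfl, h⟩; exact hy h)]
      simp
  · rw [if_neg (by tauto)]
    refine Finset.sum_eq_zero fun a _ => Finset.sum_eq_zero fun b _ => ?_
    rw [if_neg (c := a = x ∧ a = x') (by rintro ⟨rfl, h⟩; exact hx h)]
    simp

theorem marginalYX_B_privateState [Fintype E] :
    marginalYX_B (privateState p ρ V) =
      (blockDiagonal fun q : Y × X =>
        (p (q.2, q.1) : ℂ) • traceRight (V * ρ q.2 q.1 * V.conjTranspose)).submatrix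
        (Equiv.prodComm (Y × X) B) (Equiv.prodComm (Y × X) B) := by
  ext ⟨⟨y, x⟩, b⟩ ⟨⟨y', x'⟩, b'⟩
  simp only [marginalYX_B, of_apply, privateState_apply, submatrix_apply, Equiv.prodComm_apply,
    Prod.swap_prod_mk, blockDiagonal_apply]
  split_ifs with h
  · simp [traceRight, Finset.mul_sum]
  · simp

theorem marginalY_B_X_privateState [Fintype E] :
    marginalY_B_X (privateState p ρ V) =
      (blockDiagonal fun q : Y × X =>
        (p (q.2, q.1) : ℂ) • traceRight (V * ρ q.2 q.1 * V.conjTranspose)).submatrix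
        (prodRotate Y B X) (prodRotate Y B X) := by
  ext ⟨y, b, x⟩ ⟨y', b', x'⟩
  simp only [marginalY_B_X, of_apply, privateState_apply]
  change _ = if (y, x) = (y', x') then _ else (0 : ℂ)
  split_ifs with h
  · simp [traceRight, Finset.mul_sum, prodRotate]
  · simp

theorem marginalY_E_X_privateState [Fintype B] :
    marginalY_E_X (privateState p ρ V) =
      (blockDiagonal fun q : Y × X =>
        (p (q.2, q.1) : ℂ) • traceLeft (V * ρ q.2 q.1 * V.conjTranspose)).submatrix
        (prodRotate Y E X) (prodRotate Y E X) := by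
  ext ⟨y, b, x⟩ ⟨y', b', x'⟩
  simp only [marginalY_E_X, of_apply, privateState_apply]
  change _ = if (y, x) = (y', x') then _ else (0 : ℂ)
  split_ifs with h
  · simp [traceLeft, Finset.mul_sum, prodRotate]
  · simp

end PrivateState

theorem cqState_eq_blockDiagonal {A B X : Type u} [Fintype X] [DecidableEq X] (p : X → ℝ)
    (ψ : X → Matrix A A ℂ) (N : Matrix A A ℂ →ₗ[ℂ] Matrix B B ℂ) :
    cqState p ψ N = (blockDiagonal fun x => (p x : ℂ) • N (ψ x)).submatrix
      (Equiv.prodComm X B) (Equiv.prodComm X B) := by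
  ext ⟨x, b⟩ ⟨x', b'⟩
  simp only [cqState, Matrix.sum_apply, Matrix.smul_apply, kroneckerMap_apply, single_apply,
    smul_eq_mul, submatrix_apply, Equiv.prodComm_apply, Prod.swap_prod_mk, blockDiagonal_apply]
  split_ifs with h
  · subst h
    rw [Finset.sum_eq_single x]
    · simp
    · intro a _ ha
      simp [ha]
    · simp
  · refine Finset.sum_eq_zero fun a _ => ?_
    rw [if_neg (c := a = x ∧ a = x') (by rintro ⟨rfl, h'⟩; exact h h')]
    simp

/-! ### Holevo information of channels -/

section HolevoInfo

variable {A B X : Type u} [Fintype A] [DecidableEq A] [Fintype B] [DecidableEq B] [Fintype X]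
  {N : Matrix A A ℂ →ₗ[ℂ] Matrix B B ℂ}

theorem IsChannel.holevoInfo_le (hN : IsChannel N) {M : X → Matrix A A ℂ}
    (hM : ∀ x, (M x).PosSemidef) : holevoInfo (fun x => N (M x)) ≤ holevoInfo M := by
  have h := hN.entropy_sum_sub_le hM
  simp only [holevoInfo, ← map_sum, hN.trace_apply]
  linarith

/-- The trace as a channel to the trivial system. -/
def traceMap (A : Type u) [Fintype A] :
    Matrix A A ℂ →ₗ[ℂ] Matrix PUnit.{u + 1} PUnit.{u + 1} ℂ where
  toFun ρ := diagonal fun _ => ρ.trace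
  map_add' ρ σ := by ext; simp
  map_smul' c ρ := by ext; simp

theorem isChannel_traceMap : IsChannel (traceMap A) := by
  refine ⟨A, inferInstance, fun i => of fun _ a => if a = i then 1 else 0, ?_, fun ρ => ?_⟩
  · ext p q
    simp [Matrix.sum_apply, Matrix.mul_apply, one_apply]
  · ext
    simp [traceMap, trace, Matrix.sum_apply, Matrix.mul_apply]

omit [DecidableEq A] in
theorem entropy_traceMap {ρ : Matrix A A ℂ} (hρ : ρ.PosSemidef) :
    entropy (traceMap A ρ) = entropyTerm ρ.trace.re := by
  have h : traceMap A ρ = diagonal fun _ => ((ρ.trace.re : ℝ) : ℂ) := by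
    rw [hρ.ofReal_re_trace]
    rfl
  rw [h, entropy_diagonal]
  simp

/-- Data processing under the trace: on the trivial system only the Shannon part of `holevoInfo`
survives. -/
theorem holevoInfo_nonneg {M : X → Matrix A A ℂ} (hM : ∀ x, (M x).PosSemidef) :
    0 ≤ holevoInfo M := by
  have h := isChannel_traceMap.entropy_sum_sub_le hM
  simp only [entropy_traceMap (hM _), entropy_traceMap (posSemidef_sum Finset.univ fun x _ => hM x)]
    at h
  exact sub_nonneg.2 h

omit [DecidableEq A] in
theorem IsPureState.isDensity {ψ : Matrix A A ℂ} (h : IsPureState ψ) : IsDensity ψ := by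
  obtain ⟨htr, v, rfl⟩ := h
  exact ⟨posSemidef_vecMulVec_self_star v, htr⟩

theorem exists_isPureState (A : Type u) [Fintype A] [DecidableEq A] [Nonempty A] :
    ∃ ψ : Matrix A A ℂ, IsPureState ψ := by
  obtain ⟨a⟩ := ‹Nonempty A›
  refine ⟨_, ?_, Pi.single a 1, rfl⟩
  simp [trace, vecMulVec_apply, Pi.single_apply]

theorem exists_pure_decomposition {ρ : Matrix A A ℂ} (hρ : ρ.PosSemidef) :
    ∃ (l : A → ℝ) (ψ : A → Matrix A A ℂ), (∀ i, 0 ≤ l i) ∧ (∀ i, IsPureState (ψ i)) ∧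
      ρ = ∑ i, (l i : ℂ) • ψ i := by
  obtain ⟨U, l, hU, _, hd, hl, _⟩ := exists_diagonalization hρ.1
  refine ⟨l, fun i => vecMulVec (fun a => U a i) (star fun a => U a i), hl hρ, fun i =>
    ⟨?_, _, rfl⟩, ?_⟩
  · have h := congrArg (fun M => M i i) hU
    simpa [Matrix.mul_apply, trace, vecMulVec_apply, mul_comm] using h
  · conv_lhs => rw [hd]
    ext a b
    rw [Matrix.mul_apply]
    simp only [mul_diagonal, conjTranspose_apply, Matrix.sum_apply, Matrix.smul_apply,
      vecMulVec_apply, Pi.star_apply, smul_eq_mul]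
    exact Finset.sum_congr rfl fun i _ => by ring

omit [Fintype A] [DecidableEq A] in
theorem posSemidef_ofReal_smul {ρ : Matrix A A ℂ} (hρ : ρ.PosSemidef) {c : ℝ} (hc : 0 ≤ c) :
    ((c : ℂ) • ρ).PosSemidef :=
  hρ.smul (Complex.zero_le_real.2 hc)

theorem holevoInfo_smul {p : X → ℝ} (hp : p ∈ stdSimplex ℝ X) {σ : X → Matrix B B ℂ}
    (hσ : ∀ x, IsDensity (σ x)) :
    holevoInfo (fun x => (p x : ℂ) • σ x) =
      entropy (∑ x, (p x : ℂ) • σ x) - ∑ x, p x * entropy (σ x) := by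
  have h1 : (∑ x, (p x : ℂ) • σ x).trace = 1 := by
    simp only [trace_sum, trace_smul, (hσ _).2, smul_eq_mul, mul_one]
    exact_mod_cast hp.2
  simp only [holevoInfo, h1, entropy_smul (hσ _).1.1, trace_smul, (hσ _).2]
  simp [Finset.sum_add_distrib]
  ring

theorem IsChannel.mutualInfo_cqState [DecidableEq X] (hN : IsChannel N) {p : X → ℝ}
    (hp : p ∈ stdSimplex ℝ X) {ψ : X → Matrix A A ℂ} (hψ : ∀ x, IsDensity (ψ x)) :
    mutualInfo (cqState p ψ N) = holevoInfo fun x => (p x : ℂ) • N (ψ x) := by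
  rw [cqState_eq_blockDiagonal, mutualInfo_blockDiagonal]
  · exact fun x => posSemidef_ofReal_smul (hN.posSemidef (hψ x).1) (hp.1 x)
  · simp only [trace_sum, trace_smul, hN.trace_apply, (hψ _).2, smul_eq_mul, mul_one]
    exact_mod_cast hp.2

omit [DecidableEq A] in
theorem isCompact_pureStates : IsCompact {ψ : Matrix A A ℂ | IsPureState ψ} := by
  have h : {ψ : Matrix A A ℂ | IsPureState ψ} =
      (fun v : EuclideanSpace ℂ A => vecMulVec v.ofLp (star v.ofLp)) '' Metric.sphere 0 1 := by
    have key (v : EuclideanSpace ℂ A) : (vecMulVec v.ofLp (star v.ofLp)).trace = 1 ↔ ‖v‖ = 1 := by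
      rw [← sq_eq_sq₀ (norm_nonneg v) zero_le_one, EuclideanSpace.norm_sq_eq, one_pow]
      have : (vecMulVec v.ofLp (star v.ofLp)).trace = ((∑ i, ‖v.ofLp i‖ ^ 2 : ℝ) : ℂ) := by
        simp [trace, vecMulVec_apply, Complex.mul_conj']
      rw [this]
      exact_mod_cast Iff.rfl
    ext ψ
    constructor
    · rintro ⟨htr, v, rfl⟩
      exact ⟨WithLp.toLp 2 v, by simpa using (key (WithLp.toLp 2 v)).1 htr, rfl⟩
    · rintro ⟨v, hv, rfl⟩
      exact ⟨(key v).2 (by simpa using hv), _, rfl⟩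
  rw [h]
  refine (isCompact_sphere _ _).image ?_
  refine continuous_matrix fun i j => ?_
  simp only [vecMulVec_apply, Pi.star_apply]
  fun_prop

theorem IsChannel.continuousOn_entropy (hN : IsChannel N) :
    ContinuousOn (fun ρ => entropy (N ρ)) {ρ | IsDensity ρ} :=
  PrivateDynamic.continuousOn_entropy.comp
    (LinearMap.continuous_of_finiteDimensional N).continuousOn fun _ h => hN.isDensity h

theorem IsChannel.isGreatest_pureHolevo [Nonempty A] (hN : IsChannel N) :
    IsGreatest (pureHolevoValues N) (pureHolevo N) := by
  classical
  set f : Matrix A A ℂ → Matrix A A ℂ × ℝ := fun ψ => (ψ, entropy (N ψ))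
  set S := f '' {ψ | IsPureState ψ} with hS
  have hScomp : IsCompact S := isCompact_pureStates.image_of_continuousOn
    (continuousOn_id.prodMk (hN.continuousOn_entropy.mono fun ψ h => IsPureState.isDensity h))
  have hval {X : Type u} [Fintype X] [DecidableEq X] {p : X → ℝ} (hp : p ∈ stdSimplex ℝ X)
      {ψ : X → Matrix A A ℂ} (hψ : ∀ x, IsPureState (ψ x)) :
      mutualInfo (cqState p ψ N) =
        entropy (N (∑ x, p x • f (ψ x)).1) - (∑ x, p x • f (ψ x)).2 := by
    rw [hN.mutualInfo_cqState hp fun x => (hψ x).isDensity,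
      holevoInfo_smul hp fun x => hN.isDensity (hψ x).isDensity]
    simp [f, Prod.fst_sum, Prod.snd_sum, map_sum]
  -- An ensemble matters only through its average state and average output entropy, and these pairs
  -- fill exactly the convex hull of the pairs belonging to pure states.
  have himg : pureHolevoValues N =
      (fun q : Matrix A A ℂ × ℝ => entropy (N q.1) - q.2) '' convexHull ℝ S := by
    ext r
    constructor
    · rintro ⟨X, _, _, p, ψ, hp, hψ, rfl⟩
      exact ⟨∑ x, p x • f (ψ x), (convex_convexHull ℝ S).sum_mem (fun i _ => hp.1 i) hp.2
        fun x _ => subset_convexHull ℝ S ⟨_, hψ x, rfl⟩, (hval hp hψ).symm⟩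
    · rintro ⟨q, hq, rfl⟩
      obtain ⟨X, _, z, w, hz, -, hw, hw1, rfl⟩ := eq_pos_convex_span_of_mem_convexHull hq
      choose ψ hψ hψz using fun x => hz (Set.mem_range_self x)
      refine ⟨X, inferInstance, Classical.decEq X, w, ψ, ⟨fun x => (hw x).le, hw1⟩, hψ, ?_⟩
      rw [hval ⟨fun x => (hw x).le, hw1⟩ hψ]
      simp only [hψz]
  have hdens : ∀ q ∈ convexHull ℝ S, IsDensity q.1 := by
    intro q hq
    obtain ⟨X, _, z, w, hz, -, hw, hw1, rfl⟩ := eq_pos_convex_span_of_mem_convexHull hq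
    choose ψ hψ hψz using fun x => hz (Set.mem_range_self x)
    have h1 : (∑ x, w x • z x).1 = ∑ x, (w x : ℂ) • ψ x := by
      simp [← hψz, f, Prod.fst_sum]
    rw [h1]
    refine ⟨posSemidef_sum _ fun x _ =>
      posSemidef_ofReal_smul (hψ x).isDensity.1 (hw x).le, ?_⟩
    simp only [trace_sum, trace_smul, (hψ _).1, smul_eq_mul, mul_one]
    exact_mod_cast hw1
  have hcomp : IsCompact (pureHolevoValues N) := by
    rw [himg]
    refine hScomp.convexHull_of_finiteDimensional.image_of_continuousOn ?_
    exact (hN.continuousOn_entropy.comp continuousOn_fst hdens).sub continuousOn_snd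
  refine hcomp.isGreatest_sSup ?_
  obtain ⟨ψ, hψ⟩ := exists_isPureState A
  rw [himg]
  exact ⟨_, f ψ, subset_convexHull ℝ S ⟨ψ, hψ, rfl⟩, rfl⟩

/-- Mixed and unnormalized ensembles do not beat pure ones. -/
theorem IsChannel.holevoInfo_le_pureHolevo [Nonempty A] (hN : IsChannel N)
    {R : X → Matrix A A ℂ} (hR : ∀ x, (R x).PosSemidef) (htr : (∑ x, R x).trace = 1) :
    holevoInfo (fun x => N (R x)) ≤ pureHolevo N := by
  classical
  choose l ψ hl hψ hd using fun x => exists_pure_decomposition (hR x)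
  have hp : (fun q : X × A => l q.1 q.2) ∈ stdSimplex ℝ (X × A) := by
    refine ⟨fun q => hl _ _, ?_⟩
    rw [Fintype.sum_prod_type]
    simp only [hd, trace_sum, trace_smul, (hψ _ _).1, smul_eq_mul, mul_one] at htr
    exact_mod_cast htr
  refine le_trans ?_ (hN.isGreatest_pureHolevo.2 ⟨X × A, inferInstance, inferInstance, _,
    fun q => ψ q.1 q.2, hp, fun q => hψ _ _, rfl⟩)
  rw [hN.mutualInfo_cqState hp fun q => (hψ _ _).isDensity]
  have hsum : ∑ q : X × A, (l q.1 q.2 : ℂ) • N (ψ q.1 q.2) = ∑ x, N (R x) := by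
    rw [Fintype.sum_prod_type]
    refine Finset.sum_congr rfl fun x _ => ?_
    rw [hd x, map_sum]
    simp only [map_smul]
  have hx (x) : 0 ≤ holevoInfo fun i => (l x i : ℂ) • N (ψ x i) :=
    holevoInfo_nonneg fun i => posSemidef_ofReal_smul
      (hN.posSemidef (hψ x i).isDensity.1) (hl x i)
  have hNR (x) : ∑ i, (l x i : ℂ) • N (ψ x i) = N (R x) := by
    rw [hd x, map_sum]
    simp only [map_smul]
  -- Refining every member into pure states changes the Holevo quantity by the sum over x of those
  -- of the decompositions, which is nonnegative.
  have h := Finset.sum_nonneg fun x (_ : x ∈ Finset.univ) => hx x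
  simp only [holevoInfo, hNR, Finset.sum_sub_distrib] at h
  simp only [holevoInfo, hsum]
  rw [Fintype.sum_prod_type, Fintype.sum_prod_type]
  linarith

end HolevoInfo

/-! ### Antidegradable channels -/

theorem exists_mul_conjTranspose_self {A : Type*} [Fintype A] [DecidableEq A]
    {ρ : Matrix A A ℂ} (hρ : ρ.PosSemidef) : ∃ S : Matrix A A ℂ, ρ = S * S.conjTranspose := by
  obtain ⟨U, l, hU, _, hd, hl, _⟩ := exists_diagonalization hρ.1
  refine ⟨U * diagonal fun i => ((√(l i) : ℝ) : ℂ), ?_⟩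
  conv_lhs => rw [hd]
  rw [conjTranspose_mul, diagonal_conjTranspose, ← Matrix.mul_assoc, Matrix.mul_assoc U
    (diagonal _) (diagonal _), diagonal_mul_diagonal]
  congr 3
  ext i
  simp only [Pi.star_apply, Complex.star_def, Complex.conj_ofReal, ← Complex.ofReal_mul,
    Real.mul_self_sqrt (hl hρ i)]

section Complement

variable {A B E E' Y : Type u} [Fintype A] [DecidableEq A] [Fintype B] [Fintype E]
  [Fintype E'] [Fintype Y] {N : Matrix A A ℂ →ₗ[ℂ] Matrix B B ℂ}

/-- The complementary channel `ρ ↦ Tr_B (V ρ V†)`. -/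
def complementMap (V : Matrix (B × E) A ℂ) : Matrix A A ℂ →ₗ[ℂ] Matrix E E ℂ where
  toFun ρ := traceLeft (V * ρ * V.conjTranspose)
  map_add' ρ σ := by
    rw [Matrix.mul_add, Matrix.add_mul]
    exact map_add traceLeftMap _ _
  map_smul' c ρ := by
    rw [Matrix.mul_smul, Matrix.smul_mul]
    exact map_smul traceLeftMap _ _

omit [DecidableEq A] [Fintype E] in
theorem complementMap_apply (V : Matrix (B × E) A ℂ) (ρ : Matrix A A ℂ) :
    complementMap V ρ = traceLeft (V * ρ * V.conjTranspose) := rfl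

omit [DecidableEq A] in
theorem posSemidef_complementMap (V : Matrix (B × E) A ℂ) {ρ : Matrix A A ℂ}
    (hρ : ρ.PosSemidef) : (complementMap V ρ).PosSemidef :=
  posSemidef_traceLeft (hρ.mul_mul_conjTranspose_same V)

theorem IsIsometricExtension.trace_complementMap {V : Matrix (B × E) A ℂ}
    (hV : IsIsometricExtension V N) (ρ : Matrix A A ℂ) : (complementMap V ρ).trace = ρ.trace := by
  rw [complementMap_apply, trace_traceLeft, trace_mul_cycle, hV.1, Matrix.one_mul]

variable [DecidableEq B] [DecidableEq E] [DecidableEq E']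

/-- `V * S` is a vector in B ⊗ E ⊗ A, with A as reference. Read as a matrix `G` from B ⊗ A to E, it
gives the environment state as G G†, while G† G is the entrywise conjugate of the state of output
and reference, which involves `N` alone. -/
theorem IsIsometricExtension.entropy_complementMap {V : Matrix (B × E) A ℂ}
    (hV : IsIsometricExtension V N) (S : Matrix A A ℂ) :
    entropy (complementMap V (S * S.conjTranspose)) =
      entropy (of fun q q' : B × A =>
        star (N (S * single q.2 q'.2 1 * S.conjTranspose) q.1 q'.1)) := by
  set G : Matrix E (B × A) ℂ := of fun e q => (V * S) (q.1, e) q.2 with hG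
  have h1 : complementMap V (S * S.conjTranspose) = G * G.conjTranspose := by
    rw [complementMap_apply, show V * (S * S.conjTranspose) * V.conjTranspose =
      (V * S) * (V * S).conjTranspose by simp only [conjTranspose_mul, Matrix.mul_assoc]]
    ext e e'
    simp only [traceLeft, hG, Matrix.mul_apply (M := V * S), Matrix.mul_apply (M := of _),
      conjTranspose_apply, of_apply, Fintype.sum_prod_type]
  rw [h1, entropy_mul_conjTranspose_self]
  congr 1
  ext q q'
  have h2 (i j : B × E) : ((V * S) * single q.2 q'.2 (1 : ℂ) * (V * S).conjTranspose) i j =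
      (V * S) i q.2 * star ((V * S) j q'.2) := by
    rw [Matrix.mul_apply, Finset.sum_eq_single q'.2]
    · rw [mul_single_apply_same, mul_one, conjTranspose_apply]
    · intro a _ ha
      rw [mul_single_apply_of_ne _ _ _ _ _ ha, zero_mul]
    · simp
  rw [of_apply, ← hV.2, show V * (S * single q.2 q'.2 (1 : ℂ) * S.conjTranspose) *
      V.conjTranspose = (V * S) * single q.2 q'.2 (1 : ℂ) * (V * S).conjTranspose by
    simp only [conjTranspose_mul, Matrix.mul_assoc]]
  simp only [traceRight, of_apply, star_sum, h2]
  rw [Matrix.mul_apply]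
  refine Finset.sum_congr rfl fun e _ => ?_
  simp [hG, mul_comm]

theorem IsIsometricExtension.entropy_complementMap_eq {V : Matrix (B × E) A ℂ}
    {V' : Matrix (B × E') A ℂ} (hV : IsIsometricExtension V N) (hV' : IsIsometricExtension V' N)
    {ρ : Matrix A A ℂ} (hρ : ρ.PosSemidef) :
    entropy (complementMap V ρ) = entropy (complementMap V' ρ) := by
  obtain ⟨S, rfl⟩ := exists_mul_conjTranspose_self hρ
  rw [hV.entropy_complementMap, hV'.entropy_complementMap]

theorem IsIsometricExtension.holevoInfo_complementMap_eq {V : Matrix (B × E) A ℂ}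
    {V' : Matrix (B × E') A ℂ} (hV : IsIsometricExtension V N) (hV' : IsIsometricExtension V' N)
    {R : Y → Matrix A A ℂ} (hR : ∀ y, (R y).PosSemidef) :
    holevoInfo (fun y => complementMap V (R y)) =
      holevoInfo (fun y => complementMap V' (R y)) := by
  simp only [holevoInfo, ← map_sum, hV.trace_complementMap, hV'.trace_complementMap,
    hV.entropy_complementMap_eq hV' (hR _),
    hV.entropy_complementMap_eq hV' (posSemidef_sum Finset.univ fun y _ => hR y)]

/-- An antidegradable channel is less informative than each of its complementary channels. -/
theorem IsAntidegradable.holevoInfo_le (hN : IsAntidegradable N) {V : Matrix (B × E) A ℂ}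
    (hV : IsIsometricExtension V N) {R : Y → Matrix A A ℂ} (hR : ∀ y, (R y).PosSemidef) :
    holevoInfo (fun y => N (R y)) ≤ holevoInfo fun y => complementMap V (R y) := by
  obtain ⟨F, _, _, V', T, hV', hT, h⟩ := hN
  -- The degrading map is given for one particular extension, so the environment is exchanged for
  -- that one.
  rw [hV.holevoInfo_complementMap_eq hV' hR]
  have := hT.holevoInfo_le fun y => posSemidef_complementMap V' (hR y)
  simpa only [complementMap_apply, h] using this

theorem sum_ofReal_swap {X Y : Type*} [Fintype X] [Fintype Y] {p : X × Y → ℝ}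
    (hp : p ∈ stdSimplex ℝ (X × Y)) : ∑ q : Y × X, (p (q.2, q.1) : ℂ) = 1 := by
  rw [← Complex.ofReal_one, ← hp.2, Complex.ofReal_sum]
  exact Fintype.sum_equiv (Equiv.prodComm Y X) _ _ fun _ => rfl

theorem IsIsometricExtension.privateDynamicObjective_eq {X : Type u} [Fintype X] [DecidableEq X]
    [DecidableEq Y] {V : Matrix (B × E) A ℂ} (hV : IsIsometricExtension V N) (hN : IsChannel N)
    (lam mu : ℝ) {p : X × Y → ℝ} (hp : p ∈ stdSimplex ℝ (X × Y)) {ρ : X → Y → Matrix A A ℂ}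
    (hρ : ∀ x y, IsDensity (ρ x y)) :
    privateDynamicObjective lam mu (privateState p ρ V) =
      holevoInfo (fun q : Y × X => N ((p (q.2, q.1) : ℂ) • ρ q.2 q.1))
        + lam * (∑ x, holevoInfo (fun y => N ((p (x, y) : ℂ) • ρ x y))
          - ∑ x, holevoInfo (fun y => complementMap V ((p (x, y) : ℂ) • ρ x y)))
        + mu * (holevoInfo (fun q : Y × X => N ((p (q.2, q.1) : ℂ) • ρ q.2 q.1))
          - ∑ x, holevoInfo (fun y => complementMap V ((p (x, y) : ℂ) • ρ x y))) := by
  have hR (x y) : ((p (x, y) : ℂ) • ρ x y).PosSemidef :=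
    posSemidef_ofReal_smul (hρ x y).1 (hp.1 _)
  have e1 : marginalYX_B (privateState p ρ V) =
      (blockDiagonal fun q : Y × X => N ((p (q.2, q.1) : ℂ) • ρ q.2 q.1)).submatrix
        (Equiv.prodComm (Y × X) B) (Equiv.prodComm (Y × X) B) := by
    rw [marginalYX_B_privateState]
    simp only [hV.2, map_smul]
  have e2 : marginalY_B_X (privateState p ρ V) =
      (blockDiagonal fun q : Y × X => N ((p (q.2, q.1) : ℂ) • ρ q.2 q.1)).submatrix
        (prodRotate Y B X) (prodRotate Y B X) := by
    rw [marginalY_B_X_privateState]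
    simp only [hV.2, map_smul]
  have e3 : marginalY_E_X (privateState p ρ V) =
      (blockDiagonal fun q : Y × X => complementMap V ((p (q.2, q.1) : ℂ) • ρ q.2 q.1)).submatrix
        (prodRotate Y E X) (prodRotate Y E X) := by
    rw [marginalY_E_X_privateState]
    simp only [map_smul, complementMap_apply]
  have htr : (∑ q : Y × X, N ((p (q.2, q.1) : ℂ) • ρ q.2 q.1)).trace = 1 := by
    simp only [trace_sum, hN.trace_apply, trace_smul, (hρ _ _).2, smul_eq_mul, mul_one]
    exact sum_ofReal_swap hp
  rw [privateDynamicObjective, e1, e2, e3,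
    mutualInfo_blockDiagonal (fun q => hN.posSemidef (hR _ _)) htr,
    condMutualInfo_blockDiagonal (M := fun y x => N ((p (x, y) : ℂ) • ρ x y))
      (fun y x => hN.posSemidef (hR x y)),
    condMutualInfo_blockDiagonal (M := fun y x => complementMap V ((p (x, y) : ℂ) • ρ x y))
      (fun y x => posSemidef_complementMap V (hR x y))]

theorem holevoInfo_punit (M : PUnit.{u + 1} → Matrix B B ℂ) : holevoInfo M = 0 := by
  simp [holevoInfo]

/-- With a one-point Y all conditional informations vanish, and an optimal pure ensemble on X
attains the value. For the upper bound the `lam` bracket is at most 0 by antidegradability, and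
I(Y;E|X) ≥ 0 is dropped from the `mu` term. -/
theorem IsAntidegradable.isGreatest_privateDynamicValues [Nonempty A] {lam mu : ℝ}
    (hlam : 0 ≤ lam) (hmu : 0 ≤ mu) (hN : IsChannel N) (hanti : IsAntidegradable N)
    {V : Matrix (B × E) A ℂ} (hV : IsIsometricExtension V N) :
    IsGreatest (privateDynamicValues lam mu V) ((1 + mu) * pureHolevo N) := by
  constructor
  · obtain ⟨X, _, _, p, ψ, hp, hψ, h⟩ := hN.isGreatest_pureHolevo.1
    have hp' : (fun q : X × PUnit.{u + 1} => p q.1) ∈ stdSimplex ℝ (X × PUnit.{u + 1}) :=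
      ⟨fun q => hp.1 _, by simpa [Fintype.sum_prod_type] using hp.2⟩
    refine ⟨X, PUnit, inferInstance, inferInstance, inferInstance, inferInstance, _,
      fun x _ => ψ x, hp', fun x _ => (hψ x).isDensity, ?_⟩
    rw [hV.privateDynamicObjective_eq hN lam mu hp' fun x _ => (hψ x).isDensity, h,
      hN.mutualInfo_cqState hp fun x => (hψ x).isDensity]
    have e : holevoInfo (fun q : PUnit.{u + 1} × X => N ((p q.2 : ℂ) • ψ q.2)) =
        holevoInfo fun x => (p x : ℂ) • N (ψ x) := by
      simp [holevoInfo, Fintype.sum_prod_type]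
    simp only [e, holevoInfo_punit]
    simp
    ring
  · rintro _ ⟨X, Y, _, _, _, _, p, ρ, hp, hρ, rfl⟩
    rw [hV.privateDynamicObjective_eq hN lam mu hp hρ]
    have hR (x y) : ((p (x, y) : ℂ) • ρ x y).PosSemidef :=
      posSemidef_ofReal_smul (hρ x y).1 (hp.1 _)
    have h1 : holevoInfo (fun q : Y × X => N ((p (q.2, q.1) : ℂ) • ρ q.2 q.1)) ≤
        pureHolevo N := by
      refine hN.holevoInfo_le_pureHolevo (R := fun q : Y × X => (p (q.2, q.1) : ℂ) • ρ q.2 q.1)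
        (fun q => hR _ _) ?_
      simp only [trace_sum, trace_smul, (hρ _ _).2, smul_eq_mul, mul_one]
      exact sum_ofReal_swap hp
    have h2 := Finset.sum_le_sum fun x (_ : x ∈ Finset.univ) =>
      hanti.holevoInfo_le hV fun y => hR x y
    have h3 := Finset.sum_nonneg fun x (_ : x ∈ Finset.univ) =>
      holevoInfo_nonneg fun y => posSemidef_complementMap V (hR x y)
    have h4 := mul_nonneg hlam (sub_nonneg.2 h2)
    have h5 := mul_nonneg hmu h3
    have h6 := mul_le_mul_of_nonneg_left h1 (add_nonneg zero_le_one hmu)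
    linarith

theorem IsAntidegradable.privateDynamicCapacity_eq [Nonempty A] {lam mu : ℝ}
    (hlam : 0 ≤ lam) (hmu : 0 ≤ mu) (hN : IsChannel N) (hanti : IsAntidegradable N) :
    privateDynamicCapacity lam mu N = (1 + mu) * pureHolevo N := by
  refine IsGreatest.csSup_eq ⟨?_, ?_⟩
  -- Antidegradability itself provides an isometric extension, so the supremum is over a nonempty
  -- set.
  · obtain ⟨E, _, _, V, -, hV, -⟩ := id hanti
    exact ⟨E, inferInstance, inferInstance, V, hV,
      (hanti.isGreatest_privateDynamicValues hlam hmu hN hV).1⟩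
  · rintro r ⟨E, _, _, V, hV, hr⟩
    exact (hanti.isGreatest_privateDynamicValues hlam hmu hN hV).2 hr

theorem IsAntidegradable.isPrivateDynamicMax [Nonempty A] {lam mu : ℝ}
    (hlam : 0 ≤ lam) (hmu : 0 ≤ mu) (hN : IsChannel N) (hanti : IsAntidegradable N) :
    IsPrivateDynamicMax lam mu N := by
  intro E _ _ V hV
  rw [hanti.privateDynamicCapacity_eq hlam hmu hN]
  exact hanti.isGreatest_privateDynamicValues hlam hmu hN hV

end Complement

/-! ### Tensor products of channels -/

section Tensor

variable {A₁ B₁ E₁ A₂ B₂ E₂ : Type u} [Fintype A₁] [DecidableEq A₁] [Fintype B₁]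
  [Fintype E₁] [Fintype A₂] [DecidableEq A₂] [Fintype B₂] [Fintype E₂]
  {N : Matrix A₁ A₁ ℂ →ₗ[ℂ] Matrix B₁ B₁ ℂ} {M : Matrix A₂ A₂ ℂ →ₗ[ℂ] Matrix B₂ B₂ ℂ}

omit [DecidableEq A₁] [DecidableEq A₂] in
theorem IsDensity.kronecker {ρ : Matrix A₁ A₁ ℂ} {σ : Matrix A₂ A₂ ℂ} (hρ : IsDensity ρ)
    (hσ : IsDensity σ) : IsDensity (ρ ⊗ₖ σ) :=
  ⟨hρ.1.kronecker hσ.1, by rw [trace_kronecker, hρ.2, hσ.2, mul_one]⟩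

theorem IsChannel.tensorMap (hN : IsChannel N) (hM : IsChannel M) :
    IsChannel (tensorMap N M) := by
  obtain ⟨κ, _, K, hK, hN⟩ := hN
  obtain ⟨κ', _, L, hL, hM⟩ := hM
  refine ⟨κ × κ', inferInstance, fun k => K k.1 ⊗ₖ L k.2, ?_, fun ρ => ?_⟩
  · simp only [conjTranspose_kronecker, ← mul_kronecker_mul]
    rw [Fintype.sum_prod_type, ← one_kronecker_one, ← hK, ← hL]
    ext i j
    simp only [Matrix.sum_apply, kroneckerMap_apply, Finset.sum_mul_sum]
  · induction ρ using kronecker_induction with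
    | h0 => simp
    | hadd ρ σ h1 h2 =>
      rw [map_add, h1, h2]
      simp only [Matrix.mul_add, Matrix.add_mul, Finset.sum_add_distrib]
    | hk X Y =>
      rw [tensorMap_kronecker, hN, hM]
      simp only [conjTranspose_kronecker, ← mul_kronecker_mul]
      ext i j
      simp only [Matrix.sum_apply, kroneckerMap_apply, Finset.sum_mul_sum, Fintype.sum_prod_type]

omit [Fintype B₂] in
theorem traceLeft_tensorMap (hN : IsChannel N) (ρ : Matrix (A₁ × A₂) (A₁ × A₂) ℂ) :
    traceLeft (tensorMap N M ρ) = M (traceLeft ρ) := by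
  induction ρ using kronecker_induction with
  | h0 => simp [← traceLeftMap_apply]
  | hadd ρ σ h1 h2 =>
    simp only [← traceLeftMap_apply, map_add] at *
    rw [h1, h2]
  | hk X Y =>
    rw [tensorMap_kronecker, traceLeft_kronecker, traceLeft_kronecker, hN.trace_apply, map_smul]

/-- The tensor product of two isometries `A₁ → B₁ ⊗ E₁` and `A₂ → B₂ ⊗ E₂`. -/
def tensorIsometry (V : Matrix (B₁ × E₁) A₁ ℂ) (W : Matrix (B₂ × E₂) A₂ ℂ) :
    Matrix ((B₁ × B₂) × (E₁ × E₂)) (A₁ × A₂) ℂ :=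
  (V ⊗ₖ W).submatrix (Equiv.prodProdProdComm B₁ B₂ E₁ E₂) id

omit [DecidableEq A₁] [Fintype B₁] [Fintype E₁] [DecidableEq A₂] [Fintype B₂] [Fintype E₂] in
theorem tensorIsometry_conj (V : Matrix (B₁ × E₁) A₁ ℂ) (W : Matrix (B₂ × E₂) A₂ ℂ)
    (X : Matrix A₁ A₁ ℂ) (Y : Matrix A₂ A₂ ℂ) :
    tensorIsometry V W * (X ⊗ₖ Y) * (tensorIsometry V W).conjTranspose =
      ((V * X * V.conjTranspose) ⊗ₖ (W * Y * W.conjTranspose)).submatrix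
        (Equiv.prodProdProdComm B₁ B₂ E₁ E₂) (Equiv.prodProdProdComm B₁ B₂ E₁ E₂) := by
  rw [mul_kronecker_mul, mul_kronecker_mul, ← conjTranspose_kronecker]
  rfl

theorem IsIsometricExtension.tensor {V : Matrix (B₁ × E₁) A₁ ℂ} {W : Matrix (B₂ × E₂) A₂ ℂ}
    (hV : IsIsometricExtension V N) (hW : IsIsometricExtension W M) :
    IsIsometricExtension (tensorIsometry V W) (tensorMap N M) := by
  constructor
  · rw [tensorIsometry, conjTranspose_submatrix, submatrix_mul_equiv, conjTranspose_kronecker,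
      ← mul_kronecker_mul, hV.1, hW.1, one_kronecker_one]
    rfl
  · intro ρ
    induction ρ using kronecker_induction with
    | h0 => simp [← traceRightMap_apply]
    | hadd ρ σ h1 h2 =>
      simp only [← traceRightMap_apply, Matrix.mul_add, Matrix.add_mul, map_add] at *
      rw [h1, h2]
    | hk X Y =>
      rw [tensorIsometry_conj, tensorMap_kronecker, ← hV.2, ← hW.2]
      ext ⟨b, b'⟩ ⟨c, c'⟩
      simp [traceRight, Fintype.sum_prod_type, Finset.sum_mul_sum]

omit [Fintype E₁] [Fintype E₂] in
theorem complementMap_tensorIsometry [DecidableEq E₁] [DecidableEq E₂]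
    (V : Matrix (B₁ × E₁) A₁ ℂ) (W : Matrix (B₂ × E₂) A₂ ℂ)
    (ρ : Matrix (A₁ × A₂) (A₁ × A₂) ℂ) :
    complementMap (tensorIsometry V W) ρ =
      tensorMap (complementMap V) (complementMap W) ρ := by
  induction ρ using kronecker_induction with
  | h0 => simp
  | hadd ρ σ h1 h2 => rw [map_add, map_add, h1, h2]
  | hk X Y =>
    rw [complementMap_apply, tensorIsometry_conj, tensorMap_kronecker]
    ext ⟨b, b'⟩ ⟨c, c'⟩
    simp [complementMap_apply, traceLeft, Fintype.sum_prod_type, Finset.sum_mul_sum]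

theorem IsAntidegradable.tensorMap (hN : IsAntidegradable N) (hM : IsAntidegradable M) :
    IsAntidegradable (tensorMap N M) := by
  obtain ⟨E, _, _, V, T, hV, hT, h1⟩ := hN
  obtain ⟨F, _, _, W, S, hW, hS, h2⟩ := hM
  refine ⟨E × F, inferInstance, inferInstance, tensorIsometry V W,
    PrivateDynamic.tensorMap T S, hV.tensor hW, hT.tensorMap hS, fun ρ => ?_⟩
  rw [← complementMap_apply, complementMap_tensorIsometry]
  induction ρ using kronecker_induction with
  | h0 => simp
  | hadd ρ σ h1 h2 => simp only [map_add, h1, h2]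
  | hk X Y =>
    simp only [tensorMap_kronecker]
    rw [complementMap_apply, complementMap_apply, h1, h2]

end Tensor

/-! ### Entanglement-breaking channels -/

section EntanglementBreaking

variable {A B : Type u} [Fintype A] [DecidableEq A] [Fintype B]
  {N : Matrix A A ℂ →ₗ[ℂ] Matrix B B ℂ}

/-- The isometric extension built from an operator-sum form. -/
theorem isIsometricExtension_of_kraus {κ : Type u} [Fintype κ] {K : κ → Matrix B A ℂ}
    (hK : ∑ k, (K k).conjTranspose * K k = 1)
    (hN : ∀ ρ, N ρ = ∑ k, K k * ρ * (K k).conjTranspose) :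
    IsIsometricExtension (of fun q : B × κ => K q.2 q.1) N := by
  constructor
  · rw [← hK]
    ext a a'
    simp only [Matrix.mul_apply, conjTranspose_apply, of_apply, Matrix.sum_apply,
      Fintype.sum_prod_type]
    exact Finset.sum_comm
  · intro ρ
    rw [hN]
    ext b b'
    simp [traceRight, Matrix.mul_apply, Matrix.sum_apply]

-- The diagonal of the environment state is the distribution of the Kraus label: measuring the
-- environment reveals which operator acted.
omit [DecidableEq A] in
theorem complementMap_of_kraus_apply {κ : Type u} (K : κ → Matrix B A ℂ)
    (ρ : Matrix A A ℂ) (k : κ) [Fintype κ] :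
    complementMap (of fun q : B × κ => K q.2 q.1) ρ k k =
      (K k * ρ * (K k).conjTranspose).trace := by
  simp [complementMap_apply, traceLeft, trace, Matrix.mul_apply]

/-- The channel which measures in the standard basis and prepares `θ e` on outcome `e`. -/
def prepareMap {E : Type u} [Fintype E] (θ : E → Matrix B B ℂ) :
    Matrix E E ℂ →ₗ[ℂ] Matrix B B ℂ where
  toFun ω := ∑ e, ω e e • θ e
  map_add' ρ σ := by simp [add_smul, Finset.sum_add_distrib]
  map_smul' c ρ := by simp [mul_smul, Finset.smul_sum]

theorem mul_single_conj {m n l : Type*} [Fintype m] [DecidableEq m] [Fintype n] [DecidableEq n]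
    (Q : Matrix l m ℂ) (b : m) (a : n) (M : Matrix n n ℂ) :
    (Q * single b a (1 : ℂ)) * M * (Q * single b a (1 : ℂ)).conjTranspose =
      M a a • (Q * single b b (1 : ℂ) * Q.conjTranspose) := by
  rw [conjTranspose_mul, conjTranspose_single, star_one,
    show Q * single b a (1 : ℂ) * M * (single a b (1 : ℂ) * Q.conjTranspose) =
      Q * (single b a (1 : ℂ) * M * single a b (1 : ℂ)) * Q.conjTranspose by
        simp only [Matrix.mul_assoc],
    single_mul_mul_single, ← Matrix.smul_mul, ← Matrix.mul_smul, smul_single]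
  simp

theorem conjTranspose_mul_single_mul_self {m n l : Type*} [Fintype m] [DecidableEq m] [Fintype l]
    [DecidableEq n] (Q : Matrix l m ℂ) (b : m) (a : n) :
    (Q * single b a (1 : ℂ)).conjTranspose * (Q * single b a (1 : ℂ)) =
      (Q.conjTranspose * Q) b b • single a a (1 : ℂ) := by
  rw [conjTranspose_mul, conjTranspose_single, star_one,
    show single a b (1 : ℂ) * Q.conjTranspose * (Q * single b a (1 : ℂ)) =
      single a b (1 : ℂ) * (Q.conjTranspose * Q) * single b a (1 : ℂ) by
        simp only [Matrix.mul_assoc],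
    single_mul_mul_single, smul_single]
  simp

theorem isChannel_prepareMap {E : Type u} [Fintype E] [DecidableEq E] [DecidableEq B]
    {θ : E → Matrix B B ℂ} (hθ : ∀ e, IsDensity (θ e)) : IsChannel (prepareMap θ) := by
  choose Q hQ using fun e => exists_mul_conjTranspose_self (hθ e).1
  have htr (e) : ∑ b, ((Q e).conjTranspose * Q e) b b = 1 := by
    rw [← (hθ e).2, hQ e, trace_mul_comm]
    rfl
  refine ⟨E × B, inferInstance, fun q => Q q.1 * single q.2 q.1 (1 : ℂ), ?_, fun ω => ?_⟩
  · simp only [conjTranspose_mul_single_mul_self, Fintype.sum_prod_type, ← Finset.sum_smul, htr,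
      one_smul, sum_single_one]
  · simp only [mul_single_conj, Fintype.sum_prod_type, ← Finset.smul_sum, ← Matrix.sum_mul,
      ← Matrix.mul_sum, sum_single_one, Matrix.mul_one, ← hQ]
    rfl

/-- Channels of measure-and-prepare form, the measurement operators being `(S z)ᴴ * S z`. -/
def IsMeasurePrepare {A B : Type u} [Fintype A] [DecidableEq A] [Fintype B]
    (N : Matrix A A ℂ →ₗ[ℂ] Matrix B B ℂ) : Prop :=
  ∃ (Z : Type u) (_ : Fintype Z) (S : Z → Matrix A A ℂ) (θ : Z → Matrix B B ℂ),
    ∑ z, (S z).conjTranspose * S z = 1 ∧ (∀ z, IsDensity (θ z)) ∧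
      ∀ ρ, N ρ = ∑ z, (S z * ρ * (S z).conjTranspose).trace • θ z

/-- With θ_z = Q_z Q_z†, the operators Q_z |b⟩⟨a| S_z are Kraus operators of N. Their label contains
the outcome z, so measuring the environment and preparing θ_z reproduces N. -/
theorem IsMeasurePrepare.isAntidegradable [DecidableEq B] (h : IsMeasurePrepare N) :
    IsAntidegradable N := by
  classical
  obtain ⟨Z, _, S, θ, hS, hθ, hN⟩ := h
  choose Q hQ using fun z => exists_mul_conjTranspose_self (hθ z).1
  have htr (z) : ∑ b, ((Q z).conjTranspose * Q z) b b = 1 := by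
    rw [← (hθ z).2, hQ z, trace_mul_comm]
    rfl
  set K : Z × A × B → Matrix B A ℂ := fun k => Q k.1 * single k.2.2 k.2.1 (1 : ℂ) * S k.1 with hK
  have hK1 (k) : (K k).conjTranspose * K k = ((Q k.1).conjTranspose * Q k.1) k.2.2 k.2.2 •
      ((S k.1).conjTranspose * single k.2.1 k.2.1 (1 : ℂ) * S k.1) := by
    rw [← Matrix.smul_mul, ← Matrix.mul_smul, ← conjTranspose_mul_single_mul_self, hK,
      conjTranspose_mul]
    simp only [Matrix.mul_assoc]
  have hK2 (k) (ρ : Matrix A A ℂ) : K k * ρ * (K k).conjTranspose =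
      (S k.1 * ρ * (S k.1).conjTranspose) k.2.1 k.2.1 •
        (Q k.1 * single k.2.2 k.2.2 (1 : ℂ) * (Q k.1).conjTranspose) := by
    rw [← mul_single_conj, hK, conjTranspose_mul]
    simp only [Matrix.mul_assoc]
  have hV : IsIsometricExtension (of fun q : B × (Z × A × B) => K q.2 q.1) N := by
    refine isIsometricExtension_of_kraus ?_ fun ρ => ?_
    · simp only [hK1, Fintype.sum_prod_type, ← Finset.sum_smul, htr, one_smul, ← Matrix.sum_mul,
        ← Matrix.mul_sum, sum_single_one, Matrix.mul_one, hS]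
    · simp only [hK2, Fintype.sum_prod_type, ← Finset.smul_sum, ← Matrix.sum_mul,
        ← Matrix.mul_sum, sum_single_one, Matrix.mul_one, ← hQ, ← Finset.sum_smul, hN]
      rfl
  refine ⟨Z × A × B, inferInstance, inferInstance, _, prepareMap fun k => θ k.1, hV,
    isChannel_prepareMap fun k => hθ _, fun ρ => ?_⟩
  have hq (z : Z) (b : B) : (Q z * single b b (1 : ℂ) * (Q z).conjTranspose).trace =
      ((Q z).conjTranspose * Q z) b b := by
    rw [trace_mul_cycle, trace_mul_single]
    simp
  rw [← complementMap_apply]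
  simp only [prepareMap, LinearMap.coe_mk, AddHom.coe_mk, complementMap_of_kraus_apply, hK2,
    trace_smul, hq, smul_eq_mul, Fintype.sum_prod_type, ← Finset.sum_smul, ← Finset.mul_sum, htr,
    mul_one, hN]
  rfl

/-- The separable decomposition of the Choi state with weights p_z and factors σ_z, θ_z is a
measure-and-prepare form: the measurement operators are d p_z σ_zᵀ, and θ_z is prepared on outcome
z. -/
theorem IsEntanglementBreaking.isMeasurePrepare [DecidableEq B] [Nonempty A] (hN : IsChannel N)
    (h : IsEntanglementBreaking N) : IsMeasurePrepare N := by
  classical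
  set d : ℝ := (Fintype.card A : ℝ)
  have hd : (d : ℂ) ≠ 0 := by simp [d]
  have hd0 : 0 ≤ d := Nat.cast_nonneg _
  set v : A × A → ℂ := fun q => if q.1 = q.2 then 1 else 0
  set Ω : Matrix (A × A) (A × A) ℂ := ((d⁻¹ : ℝ) : ℂ) • vecMulVec v (star v) with hΩ
  have hΩd : IsDensity Ω := by
    refine ⟨posSemidef_ofReal_smul (posSemidef_vecMulVec_self_star v) (inv_nonneg.2 hd0), ?_⟩
    have : (vecMulVec v (star v)).trace = d := by
      simp [trace, vecMulVec_apply, v, Fintype.sum_prod_type, d]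
    rw [hΩ, trace_smul, this]
    simp [hd]
  obtain ⟨Z, _, p, σ, θ, hp, hσ, hθ, hsep⟩ := h A Ω hΩd
  -- The (a, a') block of d times the Choi state is the image of the matrix unit at (a, a').
  have hchoi (a a' : A) : N (single a a' 1) = ∑ z, ((d * p z : ℝ) : ℂ) • σ z a a' • θ z := by
    have hsum (i i' : A) (f : A → A → ℂ) :
        ∑ r, ∑ r', single r r' (1 : ℂ) i i' * f r r' = f i i' := by
      simp [single_apply, ite_and]
    have h1 : (d : ℂ) • Ω = ∑ r, ∑ r', single r r' (1 : ℂ) ⊗ₖ single r r' (1 : ℂ) := by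
      ext ⟨i, j⟩ ⟨i', j'⟩
      simp only [Matrix.sum_apply, kroneckerMap_apply, hsum]
      by_cases h : i' = j' <;> simp [hΩ, vecMulVec_apply, v, single_apply, hd, h]
    have h2 := congrArg (fun M => (d : ℂ) • M) hsep
    simp only [← map_smul, h1, map_sum, tensorMap_kronecker] at h2
    ext b b'
    have h3 := congrFun (congrFun h2 (a, b)) (a', b')
    simp only [Matrix.sum_apply, kroneckerMap_apply, LinearMap.id_apply, Matrix.smul_apply,
      smul_eq_mul] at h3 ⊢
    rw [hsum a a' fun r r' => N (single r r' 1) b b'] at h3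
    rw [h3, Finset.mul_sum]
    exact Finset.sum_congr rfl fun z _ => by push_cast; ring
  have hF (z) : (((d * p z : ℝ) : ℂ) • (σ z).transpose).PosSemidef :=
    posSemidef_ofReal_smul (hσ z).1.transpose (mul_nonneg hd0 (hp.1 z))
  choose S hS using fun z => exists_mul_conjTranspose_self (hF z)
  have hNρ (ρ : Matrix A A ℂ) : N ρ = ∑ z,
      ((S z).conjTranspose.conjTranspose * (S z).conjTranspose * ρ).trace • θ z := by
    have e : N ρ = ∑ a, ∑ a', ρ a a' • N (single a a' 1) := by
      conv_lhs => rw [matrix_eq_sum_single ρ]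
      simp only [map_sum, ← map_smul, smul_single, smul_eq_mul, mul_one]
    have ht (z) : ((((d * p z : ℝ) : ℂ) • (σ z).transpose) * ρ).trace =
        ∑ a, ∑ a', ρ a a' * (((d * p z : ℝ) : ℂ) * σ z a a') := by
      rw [Finset.sum_comm]
      simp only [trace, diag_apply, Matrix.mul_apply, Matrix.smul_apply, transpose_apply,
        smul_eq_mul]
      exact Finset.sum_congr rfl fun i _ => Finset.sum_congr rfl fun j _ => mul_comm _ _
    simp only [conjTranspose_conjTranspose, ← hS, ht, e, hchoi, Finset.smul_sum, Finset.sum_smul,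
      smul_smul]
    conv_rhs => rw [Finset.sum_comm]
    refine Finset.sum_congr rfl fun a _ => ?_
    conv_rhs => rw [Finset.sum_comm]
  refine ⟨Z, inferInstance, fun z => (S z).conjTranspose, θ, ?_, hθ, fun ρ => ?_⟩
  -- Completeness of the measurement is trace preservation of N, tested against every ρ.
  · refine Matrix.ext_iff_trace_mul_right.2 fun ρ => ?_
    have h1 := hN.trace_apply ρ
    rw [hNρ, trace_sum] at h1
    simp only [trace_smul, (hθ _).2, smul_eq_mul, mul_one] at h1
    rw [Matrix.one_mul, Matrix.sum_mul, trace_sum]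
    exact h1
  · rw [hNρ]
    exact Finset.sum_congr rfl fun z _ => congrArg (· • θ z) (trace_mul_cycle _ _ _).symm

end EntanglementBreaking

/-! ### Additivity of the Holevo information -/

section Additivity

variable {A₁ B₁ A₂ B₂ : Type u} [Fintype A₁] [DecidableEq A₁] [Fintype B₁] [DecidableEq B₁]
  [Fintype A₂] [DecidableEq A₂] [Fintype B₂] [DecidableEq B₂]
  {N : Matrix A₁ A₁ ℂ →ₗ[ℂ] Matrix B₁ B₁ ℂ} {M : Matrix A₂ A₂ ℂ →ₗ[ℂ] Matrix B₂ B₂ ℂ}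

theorem IsChannel.exists_pureHolevo_eq [Nonempty A₁] (hN : IsChannel N) :
    ∃ (X : Type u) (_ : Fintype X) (p : X → ℝ) (σ : X → Matrix A₁ A₁ ℂ),
      p ∈ stdSimplex ℝ X ∧ (∀ x, IsDensity (σ x)) ∧
        pureHolevo N = entropy (∑ x, (p x : ℂ) • N (σ x)) - ∑ x, p x * entropy (N (σ x)) := by
  obtain ⟨X, _, _, p, ψ, hp, hψ, h⟩ := hN.isGreatest_pureHolevo.1
  exact ⟨X, inferInstance, p, ψ, hp, fun x => (hψ x).isDensity, by
    rw [h, hN.mutualInfo_cqState hp fun x => (hψ x).isDensity,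
      holevoInfo_smul hp fun x => hN.isDensity (hψ x).isDensity]⟩

theorem isDensity_sum_smul {X B : Type*} [Fintype X] [Fintype B] {p : X → ℝ}
    (hp : p ∈ stdSimplex ℝ X) {σ : X → Matrix B B ℂ} (hσ : ∀ x, IsDensity (σ x)) :
    IsDensity (∑ x, (p x : ℂ) • σ x) := by
  refine ⟨posSemidef_sum _ fun x _ => posSemidef_ofReal_smul (hσ x).1 (hp.1 x), ?_⟩
  simp only [trace_sum, trace_smul, (hσ _).2, smul_eq_mul, mul_one]
  exact_mod_cast hp.2

theorem entropy_kronecker_density {ρ : Matrix B₁ B₁ ℂ} {σ : Matrix B₂ B₂ ℂ} (hρ : IsDensity ρ)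
    (hσ : IsDensity σ) : entropy (ρ ⊗ₖ σ) = entropy ρ + entropy σ := by
  rw [entropy_kronecker hρ.1.1 hσ.1.1, hρ.2, hσ.2]
  simp

/-- The product of optimal ensembles is a competitor for the tensor product, and entropies of
product states add. -/
theorem IsChannel.pureHolevo_add_le [Nonempty A₁] [Nonempty A₂] (hN : IsChannel N)
    (hM : IsChannel M) :
    pureHolevo N + pureHolevo M ≤ pureHolevo (PrivateDynamic.tensorMap N M) := by
  obtain ⟨X, _, p, ρ, hp, hρ, h1⟩ := hN.exists_pureHolevo_eq
  obtain ⟨Y, _, q, σ, hq, hσ, h2⟩ := hM.exists_pureHolevo_eq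
  have hNM := hN.tensorMap hM
  have hpq : (fun z : X × Y => p z.1 * q z.2) ∈ stdSimplex ℝ (X × Y) :=
    ⟨fun z => mul_nonneg (hp.1 _) (hq.1 _), by
      rw [Fintype.sum_prod_type]
      simp [← Finset.mul_sum, hp.2, hq.2]⟩
  have hd (z : X × Y) : IsDensity (ρ z.1 ⊗ₖ σ z.2) := (hρ z.1).kronecker (hσ z.2)
  have key := hNM.holevoInfo_le_pureHolevo
    (R := fun z : X × Y => ((p z.1 * q z.2 : ℝ) : ℂ) • (ρ z.1 ⊗ₖ σ z.2))
    (fun z => posSemidef_ofReal_smul (hd z).1 (hpq.1 z)) (isDensity_sum_smul hpq hd).2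
  simp only [map_smul] at key
  rw [holevoInfo_smul hpq fun z => hNM.isDensity (hd z)] at key
  have e : ∑ z : X × Y, ((p z.1 * q z.2 : ℝ) : ℂ) • PrivateDynamic.tensorMap N M (ρ z.1 ⊗ₖ σ z.2) =
      (∑ x, (p x : ℂ) • N (ρ x)) ⊗ₖ (∑ y, (q y : ℂ) • M (σ y)) := by
    ext i j
    simp only [tensorMap_kronecker, Matrix.sum_apply, Matrix.smul_apply, kroneckerMap_apply,
      smul_eq_mul, Finset.sum_mul_sum, Fintype.sum_prod_type]
    exact Finset.sum_congr rfl fun x _ => Finset.sum_congr rfl fun y _ => by push_cast; ring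
  rw [e, entropy_kronecker_density (isDensity_sum_smul hp fun x => hN.isDensity (hρ x))
    (isDensity_sum_smul hq fun x => hM.isDensity (hσ x))] at key
  have e2 : ∑ z : X × Y, p z.1 * q z.2 * entropy (PrivateDynamic.tensorMap N M (ρ z.1 ⊗ₖ σ z.2)) =
      ∑ x, p x * entropy (N (ρ x)) + ∑ y, q y * entropy (M (σ y)) := by
    simp only [tensorMap_kronecker, entropy_kronecker_density (hN.isDensity (hρ _))
      (hM.isDensity (hσ _)), Fintype.sum_prod_type]
    have e3 (x y) : p x * q y * (entropy (N (ρ x)) + entropy (M (σ y))) =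
      (p x * entropy (N (ρ x))) * q y + p x * (q y * entropy (M (σ y))) := by ring
    simp only [e3, Finset.sum_add_distrib, ← Finset.mul_sum, ← Finset.sum_mul, hp.2, hq.2,
      mul_one, one_mul]
  rw [e2] at key
  rw [h1, h2]
  linarith

/-- The unnormalized state of the first system after outcome `S` on the second. -/
def postMeasure (S : Matrix A₂ A₂ ℂ) (ρ : Matrix (A₁ × A₂) (A₁ × A₂) ℂ) : Matrix A₁ A₁ ℂ :=
  traceRight (((1 : Matrix A₁ A₁ ℂ) ⊗ₖ S) * ρ * ((1 : Matrix A₁ A₁ ℂ) ⊗ₖ S).conjTranspose)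

omit [DecidableEq A₂] in
theorem posSemidef_postMeasure (S : Matrix A₂ A₂ ℂ) {ρ : Matrix (A₁ × A₂) (A₁ × A₂) ℂ}
    (hρ : ρ.PosSemidef) : (postMeasure S ρ).PosSemidef :=
  posSemidef_traceRight (hρ.mul_mul_conjTranspose_same _)

omit [DecidableEq A₂] in
theorem postMeasure_kronecker (S : Matrix A₂ A₂ ℂ) (X : Matrix A₁ A₁ ℂ) (Y : Matrix A₂ A₂ ℂ) :
    postMeasure S (X ⊗ₖ Y) = (S * Y * S.conjTranspose).trace • X := by
  rw [postMeasure, conjTranspose_kronecker, ← mul_kronecker_mul, ← mul_kronecker_mul,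
    traceRight_kronecker]
  simp

omit [DecidableEq A₂] in
theorem postMeasure_add (S : Matrix A₂ A₂ ℂ) (ρ σ : Matrix (A₁ × A₂) (A₁ × A₂) ℂ) :
    postMeasure S (ρ + σ) = postMeasure S ρ + postMeasure S σ := by
  rw [postMeasure, Matrix.mul_add, Matrix.add_mul]
  exact map_add traceRightMap _ _

omit [DecidableEq A₂] in
theorem postMeasure_zero (S : Matrix A₂ A₂ ℂ) :
    postMeasure S (0 : Matrix (A₁ × A₂) (A₁ × A₂) ℂ) = 0 := by
  rw [postMeasure, Matrix.mul_zero, Matrix.zero_mul]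
  exact map_zero traceRightMap

theorem sum_trace_postMeasure {Z : Type*} [Fintype Z] {S : Z → Matrix A₂ A₂ ℂ}
    (hS : ∑ z, (S z).conjTranspose * S z = 1) (ρ : Matrix (A₁ × A₂) (A₁ × A₂) ℂ) :
    ∑ z, (postMeasure (S z) ρ).trace = ρ.trace := by
  induction ρ using kronecker_induction with
  | h0 => simp [postMeasure_zero]
  | hadd ρ σ h1 h2 =>
    simp only [postMeasure_add, trace_add, Finset.sum_add_distrib, h1, h2]
  | hk X Y =>
    simp only [postMeasure_kronecker, trace_smul, trace_mul_cycle (S _), smul_eq_mul]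
    rw [← Finset.sum_mul, ← trace_sum, ← Matrix.sum_mul, hS, Matrix.one_mul, trace_kronecker,
      mul_comm]

-- The measurement on the second input steers the first system to unnormalized states labelled by
-- the outcome, so the joint output is a separable sum over outcomes.
omit [Fintype B₁] [DecidableEq B₁] [Fintype B₂] [DecidableEq B₂] in
theorem tensorMap_measurePrepare {Z : Type*} [Fintype Z] {S : Z → Matrix A₂ A₂ ℂ}
    {θ : Z → Matrix B₂ B₂ ℂ}
    (hM : ∀ ρ, M ρ = ∑ z, (S z * ρ * (S z).conjTranspose).trace • θ z)
    (ρ : Matrix (A₁ × A₂) (A₁ × A₂) ℂ) :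
    tensorMap N M ρ = ∑ z, N (postMeasure (S z) ρ) ⊗ₖ θ z := by
  induction ρ using kronecker_induction with
  | h0 => simp [postMeasure_zero]
  | hadd ρ σ h1 h2 =>
    simp only [postMeasure_add, map_add, add_kronecker, Finset.sum_add_distrib, h1, h2]
  | hk X Y =>
    simp only [postMeasure_kronecker, tensorMap_kronecker, hM, map_smul, smul_kronecker]
    ext i j
    simp only [kroneckerMap_apply, Matrix.sum_apply, Matrix.smul_apply, smul_eq_mul,
      Finset.mul_sum]
    exact Finset.sum_congr rfl fun z _ => by ring

/-- The conditional entropy of a quantum system given a prepared one is at least that given the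
classical label of the preparation. -/
theorem sum_entropy_le_of_prepare {Z : Type u} [Fintype Z] {R : Z → Matrix B₁ B₁ ℂ}
    (hR : ∀ z, (R z).PosSemidef) {θ : Z → Matrix B₂ B₂ ℂ} (hθ : ∀ z, IsDensity (θ z)) :
    entropy (traceLeft (∑ z, R z ⊗ₖ θ z)) + ∑ z, entropy (R z) ≤
      entropy (∑ z, R z ⊗ₖ θ z) + ∑ z, entropyTerm (R z).trace.re := by
  -- Data processing for discarding the first factor; the contributions of the entropies of the θ_z
  -- are the same on both sides and cancel.
  have h := isChannel_traceLeft.entropy_sum_sub_le (M := fun z => R z ⊗ₖ θ z)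
    fun z => (hR z).kronecker (hθ z).1
  have e1 (z) : entropy (R z ⊗ₖ θ z) = entropy (R z) + (R z).trace.re * entropy (θ z) := by
    rw [entropy_kronecker (hR z).1 (hθ z).1.1, (hθ z).2]
    simp
  have e2 (z) : entropy (traceLeftMap (R z ⊗ₖ θ z)) =
      entropyTerm (R z).trace.re + (R z).trace.re * entropy (θ z) := by
    rw [traceLeftMap_apply, traceLeft_kronecker, ← (hR z).ofReal_re_trace,
      entropy_smul (hθ z).1.1, (hθ z).2]
    simp
  simp only [e1, e2, Finset.sum_add_distrib] at h
  rw [traceLeftMap_apply] at h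
  linarith

/-- Subadditivity bounds the entropy of the average output above by that of its marginals. For each
signal, the joint output entropy is at least the entropy of the second output plus that of the first
given the outcome z. The difference splits into the Holevo quantity of N on the ensemble labelled by
(x, z) and that of M on the reduced ensemble. -/
theorem IsMeasurePrepare.pureHolevo_tensorMap_le [Nonempty A₁] [Nonempty A₂] (hN : IsChannel N)
    (hM : IsChannel M) (hMP : IsMeasurePrepare M) :
    pureHolevo (tensorMap N M) ≤ pureHolevo N + pureHolevo M := by
  have hNM := hN.tensorMap hM
  obtain ⟨X, _, _, p, ψ, hp, hψ, h⟩ := hNM.isGreatest_pureHolevo.1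
  rw [h, hNM.mutualInfo_cqState hp fun x => (hψ x).isDensity]
  obtain ⟨Z, _, S, θ, hS, hθ, hMf⟩ := hMP
  set R : X → Matrix (A₁ × A₂) (A₁ × A₂) ℂ := fun x => (p x : ℂ) • ψ x with hR
  have hRp (x) : (R x).PosSemidef := posSemidef_ofReal_smul (hψ x).isDensity.1 (hp.1 x)
  have hRtr : (∑ x, R x).trace = 1 := (isDensity_sum_smul hp fun x => (hψ x).isDensity).2
  simp only [← map_smul]
  change holevoInfo (fun x => tensorMap N M (R x)) ≤ _
  have hWp (x z) : (postMeasure (S z) (R x)).PosSemidef := posSemidef_postMeasure _ (hRp x)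
  have h1 : holevoInfo (fun q : X × Z => N (postMeasure (S q.2) (R q.1))) ≤ pureHolevo N := by
    refine hN.holevoInfo_le_pureHolevo (R := fun q : X × Z => postMeasure (S q.2) (R q.1))
      (fun q => hWp _ _) ?_
    rw [trace_sum, Fintype.sum_prod_type]
    simp only [sum_trace_postMeasure hS]
    rw [← trace_sum, hRtr]
  have h2 : holevoInfo (fun x => M (traceLeft (R x))) ≤ pureHolevo M := by
    refine hM.holevoInfo_le_pureHolevo (R := fun x => traceLeft (R x))
      (fun x => posSemidef_traceLeft (hRp x)) ?_
    simp only [trace_sum, trace_traceLeft]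
    rw [← trace_sum, hRtr]
  have hout : IsDensity (tensorMap N M (∑ x, R x)) :=
    hNM.isDensity ⟨posSemidef_sum _ fun x _ => hRp x, hRtr⟩
  have hright (ρ : Matrix (A₁ × A₂) (A₁ × A₂) ℂ) :
      traceRight (tensorMap N M ρ) = ∑ z, N (postMeasure (S z) ρ) := by
    rw [tensorMap_measurePrepare hMf, ← traceRightMap_apply, map_sum]
    simp only [traceRightMap_apply, traceRight_kronecker, (hθ _).2, one_smul]
  have h3 := entropy_le_traceRight_add_traceLeft hout
  have hpm (S : Matrix A₂ A₂ ℂ) : postMeasure S (∑ x, R x) = ∑ x, postMeasure S (R x) :=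
    map_sum (⟨⟨postMeasure S, postMeasure_zero S⟩, postMeasure_add S⟩ :
      Matrix (A₁ × A₂) (A₁ × A₂) ℂ →+ Matrix A₁ A₁ ℂ) R Finset.univ
  rw [hright, traceLeft_tensorMap hN] at h3
  have h4 := Finset.sum_le_sum fun x (_ : x ∈ Finset.univ) =>
    sum_entropy_le_of_prepare (fun z => hN.posSemidef (hWp x z)) hθ
  simp only [← tensorMap_measurePrepare hMf, traceLeft_tensorMap hN, Finset.sum_add_distrib]
    at h4
  have e1 : ∑ q : X × Z, N (postMeasure (S q.2) (R q.1)) =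
      ∑ z, N (postMeasure (S z) (∑ x, R x)) := by
    simp only [hpm, map_sum]
    rw [Fintype.sum_prod_type, Finset.sum_comm]
  have e2 : ∑ x, M (traceLeft (R x)) = M (traceLeft (∑ x, R x)) := by
    rw [← traceLeftMap_apply, map_sum, map_sum]
    rfl
  simp only [holevoInfo, e1, e2, Fintype.sum_prod_type] at h1 h2
  have t1 : (∑ z, N (postMeasure (S z) (∑ x, R x))).trace = 1 := by
    simp only [trace_sum, hN.trace_apply]
    rw [sum_trace_postMeasure hS, hRtr]
  rw [t1] at h1
  rw [hM.trace_apply, trace_traceLeft, hRtr] at h2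
  simp only [hM.trace_apply, trace_traceLeft] at h2
  simp only [holevoInfo, ← map_sum, hNM.trace_apply, hRtr]
  simp only [Complex.one_re, entropyTerm_one] at *
  linarith

end Additivity

end

end PrivateDynamic

theorem mainTheorem5 (lam mu : ℝ) (hlam : 0 ≤ lam) (hmu : 0 ≤ mu) :
    (∀ (A B : Type u) [Fintype A] [DecidableEq A] [Nonempty A] [Fintype B] [DecidableEq B]
      (N : Matrix A A ℂ →ₗ[ℂ] Matrix B B ℂ),
      PrivateDynamic.IsChannel N → PrivateDynamic.IsAntidegradable N →
        IsGreatest (PrivateDynamic.pureHolevoValues N) (PrivateDynamic.pureHolevo N) ∧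
        PrivateDynamic.IsPrivateDynamicMax lam mu N ∧
        PrivateDynamic.privateDynamicCapacity lam mu N =
          (1 + mu) * PrivateDynamic.pureHolevo N) ∧
    (∀ (A₁ B₁ A₂ B₂ : Type u)
      [Fintype A₁] [DecidableEq A₁] [Nonempty A₁] [Fintype B₁] [DecidableEq B₁]
      [Fintype A₂] [DecidableEq A₂] [Nonempty A₂] [Fintype B₂] [DecidableEq B₂]
      (N : Matrix A₁ A₁ ℂ →ₗ[ℂ] Matrix B₁ B₁ ℂ) (M : Matrix A₂ A₂ ℂ →ₗ[ℂ] Matrix B₂ B₂ ℂ),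
      PrivateDynamic.IsChannel N → PrivateDynamic.IsAntidegradable N →
      PrivateDynamic.IsChannel M → PrivateDynamic.IsEntanglementBreaking M →
        PrivateDynamic.IsPrivateDynamicMax lam mu M ∧
        PrivateDynamic.IsPrivateDynamicMax lam mu (PrivateDynamic.tensorMap N M) ∧
        PrivateDynamic.privateDynamicCapacity lam mu (PrivateDynamic.tensorMap N M) =
          PrivateDynamic.privateDynamicCapacity lam mu N +
            PrivateDynamic.privateDynamicCapacity lam mu M) := by
  refine ⟨fun A B _ _ _ _ _ N hN hanti => ⟨hN.isGreatest_pureHolevo,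
    hanti.isPrivateDynamicMax hlam hmu hN, hanti.privateDynamicCapacity_eq hlam hmu hN⟩, ?_⟩
  intro A₁ B₁ A₂ B₂ _ _ _ _ _ _ _ _ _ _ N M hN hanti hM hEB
  have hMP := hEB.isMeasurePrepare hM
  have hNM := hanti.tensorMap hMP.isAntidegradable
  refine ⟨hMP.isAntidegradable.isPrivateDynamicMax hlam hmu hM,
    hNM.isPrivateDynamicMax hlam hmu (hN.tensorMap hM), ?_⟩
  -- All three channels are antidegradable, so each capacity is (1 + mu) times its Holevo optimum,
  -- and the claim becomes additivity of that optimum.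
  rw [hNM.privateDynamicCapacity_eq hlam hmu (hN.tensorMap hM),
    hanti.privateDynamicCapacity_eq hlam hmu hN,
    hMP.isAntidegradable.privateDynamicCapacity_eq hlam hmu hM, ← mul_add,
    le_antisymm (hMP.pureHolevo_tensorMap_le hN hM) (hN.pureHolevo_add_le hM)]
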